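/- **Conventions.** $K$ is an abstract elementary class (AEC) in a language $L$: a class of $L$-structures closed under isomorphism, with a partial order $\prec$ on $K$ refining "substructure" and respected by isomorphisms, satisfying coherence (if $M_0\prec M_2$, $M_1\prec M_2$ and $M_0\subseteq M_1$, then $M_0\prec M_1$), the Tarski–Vaught chain axioms (the union $U$ of a $\prec$-increasing continuous chain $\langle M_i: i<\delta\rangle$, $\delta$ limit, is in $K$, each $M_i\prec U$, and $U\prec N$ whenever all $M_i\prec N$), and the Löwenheim–Skolem axiom; $\mathrm{LS}(K)\ge |L|+\aleph_0$ is the least cardinal such that for all $M\in K$ and $A\subseteq |M|$ there is $M_0\prec M$ containing $A$ with $\|M_0\|\le |A|+\mathrm{LS}(K)$. Chains and sequences of ordinals are increasing in the weak sense. Let $\mathcal F=[\lambda,\theta)$, where $\lambda$ is a cardinal and $\theta>\lambda$ is a cardinal or $\infty$, and let $K_{\mathcal F}=\{M\in K:\|M\|\in\mathcal F\}$. A $K$-embedding $f:M\to N$ is an isomorphism of $M$ onto some $f[M]\prec N$. For $n<\omega$, $S^n(M)$ is the set of Galois types $\mathrm{tp}(\bar a/M;N)$ with $M\prec N\in K$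 and $\bar a\in{}^nN$, i.e. the classes of the equivalence relation generated by: $(\bar a,M,N)\sim(\bar b,M,N')$ if there are $N''$ and $K$-embeddings $f:N\to N''$, $g:N'\to N''$ fixing $M$ pointwise with $f(\bar a)=g(\bar b)$. For $p=\mathrm{tp}(\bar a/M;N)\in S^n(M)$, put $\ell(p)=n$; for $m\le n$ and $M_0\prec M$, $p^m\upharpoonright M_0:=\mathrm{tp}(\langle a_i:i<m\rangle/M_0;N)$; and $p$ is nonalgebraic if no $a_i$ lies in $M$. **Frames.** Let $\alpha\le\omega$. A *pre-$(<\alpha,\mathcal F)$-frame* is a triple $\mathfrak s=(K,\perp,S^{bs})$, where $K$ is an AEC with $\mathrm{LS}(K)\le\lambda$ and a model of cardinality $\lambda$; $S^{bs}$ is a set of nonalgebraic types (the *basic* types) of lengths $<\alpha$ over models in $K_{\mathcal F}$; and $\perp$ is a relation on quadruples $(M_0,M_1,\bar a,N)$ with $M_0\prec M_1\prec N$ in $K_{\mathcal F}$ and $\bar a$ a sequence from $N$ of length $<\alpha$, such that: - *Invariance:* if $f:N\cong N'$, then $\perp(M_0,M_1,\bar a,N)$ implies $\perp(f[M_0],f[M_1],f(\bar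 a),N')$, and $\mathrm{tp}(\bar a/M_1;N)\in S^{bs}$ implies $\mathrm{tp}(f(\bar a)/f[M_1];N')\in S^{bs}$. - *Monotonicity:* if $\perp(M_0,M_1,\bar a,N)$, $\bar a'$ is a subsequence of $\bar a$, $M_0\prec M_0'\prec M_1'\prec M_1\prec N'\prec N\prec N''\in K_{\mathcal F}$ and $\bar a'\in N'$, then $\perp(M_0',M_1',\bar a',N')$ and $\perp(M_0',M_1',\bar a',N'')$; and if $\mathrm{tp}(\bar a/M_1;N)\in S^{bs}$, then $\mathrm{tp}(\bar a'/M_1;N)\in S^{bs}$ for every subsequence $\bar a'$ of $\bar a$. - *Nonforking types are basic:* $\perp(M,M,\bar a,N)$ implies $\mathrm{tp}(\bar a/M;N)\in S^{bs}$. A type $p$ over $M_1$ *does not fork over* $M_0$ if $\perp(M_0,M_1,\bar a,N)$ for some $\bar a,N$ with $p=\mathrm{tp}(\bar a/M_1;N)$. A *good $(<\alpha,\mathcal F)$-frame* is a pre-$(<\alpha,\mathcal F)$-frame such that: 1. $K_{\mathcal F}$ has amalgamation, joint embedding and no maximal models. 2. *bs-stability:* there are at most $\|M\|$ basic types of length $1$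 over $M$, for all $M\in K_{\mathcal F}$. 3. *Density:* if $M\prec N$ are in $K_{\mathcal F}$ and $M\ne N$, some $a\in N$ has $\mathrm{tp}(a/M;N)\in S^{bs}$. 4. *Existence:* if $p\in S^{bs}$ is over $M$, $M\prec N\in K_{\mathcal F}$ and $\ell(p)\le\beta<\alpha$, there is a basic $q$ over $N$ of length $\beta$ that does not fork over $M$ with $q^{\ell(p)}\upharpoonright M=p$. 5. *Uniqueness:* if $p,q\in S^{n}(N)$, $n<\alpha$, do not fork over $M$ and $p\upharpoonright M=q\upharpoonright M$, then $p=q$. 6. *Symmetry:* if $\perp(M_0,M_2,\bar a_1,N)$, $\bar a_2$ is a sequence from $M_2$ of length $<\alpha$ and $\mathrm{tp}(\bar a_2/M_0;N)\in S^{bs}$, then there are $M_1$ containing $\bar a_1$ and $N'\succ N$ with $\perp(M_0,M_1,\bar a_2,N')$. 7. *Local character:* if $\delta$ is a limit ordinal, $\langle M_i\in K_{\mathcal F}:i\le\delta\rangle$ is increasing continuous, and $p\in S^{bs}$ is over $M_\delta$ with $\ell(p)<\mathrm{cf}(\delta)$, then $p$ does not fork over $M_i$ for some $i<\delta$. 8.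 *Continuity:* if $\delta$ is a limit ordinal, $\langle M_i\in K_{\mathcal F}:i\le\delta\rangle$ and $\langle\alpha_i<\alpha:i\le\delta\rangle$ are increasing continuous, and $p_i$ ($i<\delta$) is a basic type over $M_i$ of length $\alpha_i$ with $p_j=p_i^{\alpha_j}\upharpoonright M_j$ for $j<i<\delta$, then there is a basic $p$ over $M_\delta$ of length $\alpha_\delta$ with $p_i=p^{\alpha_i}\upharpoonright M_i$ for all $i<\delta$ and such that, if no $p_i$ forks over $M_0$, then $p$ does not fork over $M_0$. 9. *Transitivity:* if $M_0\prec M_1\prec M_2$, $p$ is a type over $M_2$ of length $<\alpha$ that does not fork over $M_1$, and $p\upharpoonright M_1$ does not fork over $M_0$, then $p$ does not fork over $M_0$. It is *good except bs-stability* if all of this holds except possibly 2. A good $\mathcal F$-frame (with no length mentioned) is a good $(<2,\mathcal F)$-frame, i.e. one for sequences of length at most $1$; similarly for good except bs-stability. **Elongation.** Let $\mathfrak s$ be a frame for sequences of length at most $1$. For $n<\omega$, a sequence $\bar a=\langle a_i:i<n\rangle$ from $N$ is *independent from $M_0$ over $M$ in $N$* if $M\prec M_0\prec N$ and there are $N^+\succ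 N$ and models $M_0\prec M_1\prec\dots\prec M_n\prec N^+$, with $M$ and all $M_i$ in $K_{\mathcal F}$, such that $\perp(M,M_i,a_i,M_{i+1})$ for all $i<n$. The elongation $\mathfrak s^{<\omega}=(K,\perp^{<\omega},S^{bs,<\omega})$ is given by: for $M_0\prec M_1\prec N$ in $K_{\mathcal F}$ and a finite sequence $\bar a$ from $N$, $\perp^{<\omega}(M_0,M_1,\bar a,N)$ iff $\bar a$ is independent from $M_1$ over $M_0$ in $N$; and for $M\in K_{\mathcal F}$, a type $p$ over $M$ of finite length is in $S^{bs,<\omega}$ iff $p=\mathrm{tp}(\bar a/M;N)$ for some $N$ and $\bar a$ with $\perp^{<\omega}(M,M,\bar a,N)$. **Corollary 4.6** (solution of Shelah's Exercise III.9.4.1). If $\mathfrak s$ is a good $\mathcal F$-frame, then $\mathfrak s^{<\omega}$ is a good $(<\omega,\mathcal F)$-frame. If $\mathfrak s$ is good except bs-stability, then $\mathfrak s^{<\omega}$ is a $(<\omega,\mathcal F)$-frame that is good except bs-stability. (In both cases this includes symmetry.) -/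

import Mathlib

universe u

namespace GoodFrame

open FirstOrder Cardinal

section Structures

variable {L : FirstOrder.Language.{u, u}}

/-- An `L`-structure in the sense of set theory: its universe is a set of sets. Working with
structures on honest sets lets `M ⊆ N`, unions of chains and "the same element of two models"
have their literal meaning. -/
structure Model (L : FirstOrder.Language.{u, u}) where
  carrier : Set ZFSet.{u}
  small : Small.{u} carrier
  str : L.Structure carrier

attribute [instance] Model.small Model.str

/-- The cardinality `‖M‖`. -/
noncomputable def Model.size (M : Model L) : Cardinal.{u} := #(Shrink.{u} M.carrier)

/-- `f` restricts to an isomorphism of `M` onto `N`. Maps between models are restrictions of maps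
defined everywhere; only the values on `M` matter. In particular `N` is the structure `f[M]`. -/
def IsIso (f : ZFSet.{u} → ZFSet.{u}) (M N : Model L) : Prop :=
  ∃ e : M.carrier ≃[L] N.carrier, ∀ x, (e x : ZFSet.{u}) = f x

/-- `M` is a substructure of `N`: the universe of `M` is contained in that of `N` and the inclusion
is an embedding of `L`-structures. -/
def Model.IsSubstructure (M N : Model L) : Prop :=
  ∃ e : M.carrier ↪[L] N.carrier, ∀ x, (e x : ZFSet.{u}) = x

/-- The structure `U` is the union of the structures `M i`, `i < δ`. -/
def IsUnion (M : Ordinal.{u} → Model L) (δ : Ordinal.{u}) (U : Model L) : Prop :=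
  U.carrier = {x | ∃ i < δ, x ∈ (M i).carrier} ∧ ∀ i < δ, (M i).IsSubstructure U

/-- `⟨M i : i < δ⟩` is increasing (not necessarily strictly) with respect to the relation `r`, and
continuous: unions are taken at limits. The values `M i` for `i ≥ δ` are irrelevant. -/
def IncreasingContinuous (r : Model L → Model L → Prop) (δ : Ordinal.{u})
    (M : Ordinal.{u} → Model L) : Prop :=
  (∀ i j, i ≤ j → j < δ → r (M i) (M j)) ∧
    ∀ i < δ, Order.IsSuccLimit i → IsUnion M i (M i)

end Structures

/-- The cardinal `κ` satisfies the downward Löwenheim-Skolem axiom for the class `Mem` with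
the ordering `Prec`. -/
def LowenheimSkolem {L : FirstOrder.Language.{u, u}} (Mem : Model L → Prop)
    (Prec : Model L → Model L → Prop) (κ : Cardinal.{u}) : Prop :=
  ℵ₀ ≤ κ ∧ L.card ≤ κ ∧ ∀ M, Mem M → ∀ A ⊆ M.carrier, ∃ M₀, Prec M₀ M ∧ A ⊆ M₀.carrier ∧
    Cardinal.lift.{u + 1} M₀.size ≤ #A + Cardinal.lift.{u + 1} κ

/-- An abstract elementary class: a class `Mem` of `L`-structures with a partial order
`Prec` (written `M ≺ N`) on it. -/
structure AEC (L : FirstOrder.Language.{u, u}) where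
  Mem : Model L → Prop
  Prec : Model L → Model L → Prop
  mem_of_prec : ∀ {M N}, Prec M N → Mem M ∧ Mem N
  refl : ∀ {M}, Mem M → Prec M M
  trans : ∀ {M₀ M₁ M₂}, Prec M₀ M₁ → Prec M₁ M₂ → Prec M₀ M₂
  isSubstructure : ∀ {M N}, Prec M N → M.IsSubstructure N
  mem_iso : ∀ {f M M'}, Mem M → IsIso f M M' → Mem M'
  prec_iso : ∀ {f M N M' N'}, Prec M N → IsIso f M M' → IsIso f N N' → Prec M' N'
  coherence : ∀ {M₀ M₁ M₂}, Prec M₀ M₂ → Prec M₁ M₂ → M₀.IsSubstructure M₁ → Prec M₀ M₁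
  chain : ∀ {δ : Ordinal.{u}} {M : Ordinal.{u} → Model L} {U : Model L}, Order.IsSuccLimit δ →
    IncreasingContinuous Prec δ M → IsUnion M δ U →
      Mem U ∧ (∀ i < δ, Prec (M i) U) ∧ ∀ N, (∀ i < δ, Prec (M i) N) → Prec U N
  exists_lowenheimSkolem : ∃ κ : Cardinal.{u}, LowenheimSkolem Mem Prec κ

section Types

variable {L : FirstOrder.Language.{u, u}} (K : AEC L)

/-- The Löwenheim-Skolem number `LS(K)`: the least cardinal `≥ |L| + ℵ₀` for which the downward
Löwenheim-Skolem axiom holds. -/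
noncomputable def AEC.LS : Cardinal.{u} := sInf {κ | LowenheimSkolem K.Mem K.Prec κ}

/-- `M ∈ K_𝓕` for the interval of cardinals `𝓕 = [lam, th)`, where `th = ⊤` stands for `∞`. -/
def AEC.InF (lam : Cardinal.{u}) (th : WithTop Cardinal.{u}) (M : Model L) : Prop :=
  K.Mem M ∧ lam ≤ M.size ∧ (M.size : WithTop Cardinal.{u}) < th

/-- `f : M → N` is a `K`-embedding, i.e. `f : M ≅ f[M] ≺ N`. -/
def AEC.IsEmb (f : ZFSet.{u} → ZFSet.{u}) (M N : Model L) : Prop :=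
  ∃ R, IsIso f M R ∧ K.Prec R N

/-- A triple `(ā, M, N)` with `M ≺ N` and `ā` a finite sequence of length `n` from `N`. -/
structure Realization (M : Model L) (n : ℕ) where
  ambient : Model L
  prec : K.Prec M ambient
  tuple : Fin n → ZFSet.{u}
  mem : ∀ i, tuple i ∈ ambient.carrier

variable {K}

/-- The ambient models of the two triples can be `K`-embedded over `M` into one model so that the
two sequences become equal. -/
def Realization.AtomicEq {M : Model L} {n : ℕ} (p q : Realization K M n) : Prop :=
  ∃ (N : Model L) (f g : ZFSet.{u} → ZFSet.{u}),
    K.IsEmb f p.ambient N ∧ K.IsEmb g q.ambient N ∧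
    (∀ x ∈ M.carrier, f x = x ∧ g x = x) ∧ ∀ i, f (p.tuple i) = g (q.tuple i)

variable (K) in
/-- `S^n(M)`: Galois types over `M` of sequences of finite length `n`, that is, classes of the
equivalence relation generated by `AtomicEq`. -/
def GType (M : Model L) (n : ℕ) : Type (u + 1) :=
  Quot (Realization.AtomicEq (K := K) (M := M) (n := n))

/-- `tp(ā / M; N)`. -/
def tp {M N : Model L} {n : ℕ} {a : Fin n → ZFSet.{u}} (h : K.Prec M N)
    (ha : ∀ i, a i ∈ N.carrier) : GType K M n :=
  Quot.mk _ ⟨N, h, a, ha⟩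

/-- `p^m ↾ M₀`: the restriction of `p ∈ S^n(M)` to the first `m ≤ n` coordinates and to `M₀ ≺ M`. -/
def GType.restrict {M₀ M : Model L} {m n : ℕ} (p : GType K M n) (hM : K.Prec M₀ M) (hm : m ≤ n) :
    GType K M₀ m :=
  Quot.map
    (fun r : Realization K M n =>
      (⟨r.ambient, K.trans hM r.prec, fun i => r.tuple (Fin.castLE hm i), fun i => r.mem _⟩ :
        Realization K M₀ m))
    (fun _ _ ⟨N, f, g, hf, hg, hfg, hi⟩ =>
      ⟨N, f, g, hf, hg,
        fun x hx => hfg x (by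
          obtain ⟨e, he⟩ := K.isSubstructure hM
          have hex := (e ⟨x, hx⟩).2
          rwa [he] at hex),
        fun i => hi _⟩) p

/-- `q ∈ S^n(N)` extends `p ∈ S^m(M)`: `M ≺ N`, `m ≤ n` and `q^m ↾ M = p`. -/
def GType.Extends {M N : Model L} {m n : ℕ} (q : GType K N n) (p : GType K M m) : Prop :=
  ∃ (hM : K.Prec M N) (hm : m ≤ n), q.restrict hM hm = p

/-- The type of a sequence none of whose members lies in the domain `M`. -/
def GType.Nonalgebraic {M : Model L} {n : ℕ} (p : GType K M n) : Prop :=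
  ∃ r : Realization K M n, Quot.mk _ r = p ∧ ∀ i, r.tuple i ∉ M.carrier

end Types

section Frames

variable {L : FirstOrder.Language.{u, u}} {K : AEC L}

variable (K) in
/-- The data `(K, ⫝, S^bs)` of a frame for finite sequences: `nf M₀ M₁ a N` is the nonforking
relation "`a` does not fork from `M₁` over `M₀` inside `N`" and `bs M n` is the set of basic types
of length `n` over `M`. The axioms come afterwards. -/
structure FrameTriple where
  nf : ∀ (_ _ : Model L) {n : ℕ} (_ : Fin n → ZFSet.{u}) (_ : Model L), Prop
  bs : ∀ (M : Model L) (n : ℕ), Set (GType K M n)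

/-- `tp(a / M; N) ∈ S^bs(M)`. -/
def FrameTriple.Basic (s : FrameTriple K) (M : Model L) {n : ℕ} (a : Fin n → ZFSet.{u})
    (N : Model L) : Prop :=
  ∃ (h : K.Prec M N) (ha : ∀ i, a i ∈ N.carrier), tp h ha ∈ s.bs M n

/-- The type `p` over `M₁` does not fork over `M₀`. -/
def FrameTriple.DoesNotFork (s : FrameTriple K) {M₁ : Model L} {n : ℕ} (p : GType K M₁ n)
    (M₀ : Model L) : Prop :=
  ∃ (a : Fin n → ZFSet.{u}) (N : Model L) (h : K.Prec M₁ N) (ha : ∀ i, a i ∈ N.carrier),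
    p = tp h ha ∧ s.nf M₀ M₁ a N

/-- `s` is a pre-`(<α, 𝓕)`-frame, where `𝓕 = [lam, th)` and `α ≤ ω` (so `α = ⊤` stands
for `ω`). -/
structure IsPreFrame (α : ℕ∞) (lam : Cardinal.{u}) (th : WithTop Cardinal.{u})
    (s : FrameTriple K) : Prop where
  lt : (lam : WithTop Cardinal.{u}) < th
  ls_le : K.LS ≤ lam
  exists_size_eq : ∃ M, K.Mem M ∧ M.size = lam
  bs_subset : ∀ {M : Model L} {n : ℕ}, ∀ p ∈ s.bs M n,
    K.InF lam th M ∧ (n : ℕ∞) < α ∧ p.Nonalgebraic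
  nf_domain : ∀ {M₀ M₁ N : Model L} {n : ℕ} {a : Fin n → ZFSet.{u}}, s.nf M₀ M₁ a N →
    K.InF lam th M₀ ∧ K.InF lam th M₁ ∧ K.InF lam th N ∧ K.Prec M₀ M₁ ∧ K.Prec M₁ N ∧
      (∀ i, a i ∈ N.carrier) ∧ (n : ℕ∞) < α
  nf_invariance : ∀ {M₀ M₁ N M₀' M₁' N' : Model L} {n : ℕ} {a : Fin n → ZFSet.{u}}
    {f : ZFSet.{u} → ZFSet.{u}}, IsIso f N N' → IsIso f M₀ M₀' → IsIso f M₁ M₁' →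
      s.nf M₀ M₁ a N → s.nf M₀' M₁' (fun i => f (a i)) N'
  bs_invariance : ∀ {M N M' N' : Model L} {n : ℕ} {a : Fin n → ZFSet.{u}}
    {f : ZFSet.{u} → ZFSet.{u}}, IsIso f N N' → IsIso f M M' →
      s.Basic M a N → s.Basic M' (fun i => f (a i)) N'
  nf_monotonicity : ∀ {M₀ M₀' M₁' M₁ N' N N'' : Model L} {m n : ℕ} {a : Fin n → ZFSet.{u}}
    (e : Fin m ↪o Fin n), s.nf M₀ M₁ a N →
      K.Prec M₀ M₀' → K.Prec M₀' M₁' → K.Prec M₁' M₁ → K.Prec M₁ N' → K.Prec N' N →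
      K.Prec N N'' → K.InF lam th N'' → (∀ i, a (e i) ∈ N'.carrier) →
        s.nf M₀' M₁' (fun i => a (e i)) N' ∧ s.nf M₀' M₁' (fun i => a (e i)) N''
  bs_monotonicity : ∀ {M N : Model L} {m n : ℕ} {a : Fin n → ZFSet.{u}} (e : Fin m ↪o Fin n),
    s.Basic M a N → s.Basic M (fun i => a (e i)) N
  basic_of_nf : ∀ {M N : Model L} {n : ℕ} {a : Fin n → ZFSet.{u}}, s.nf M M a N → s.Basic M a N

/-- `s` is a pre-`(<α, 𝓕)`-frame that has all the properties of a good `(<α, 𝓕)`-frame, except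
possibly bs-stability. -/
structure IsGoodExceptStability (α : ℕ∞) (lam : Cardinal.{u}) (th : WithTop Cardinal.{u})
    (s : FrameTriple K) : Prop extends IsPreFrame α lam th s where
  amalgamation : ∀ {M₀ M₁ M₂ : Model L}, K.InF lam th M₀ → K.InF lam th M₁ → K.InF lam th M₂ →
    K.Prec M₀ M₁ → K.Prec M₀ M₂ → ∃ (N : Model L) (f₁ f₂ : ZFSet.{u} → ZFSet.{u}),
      K.InF lam th N ∧ K.IsEmb f₁ M₁ N ∧ K.IsEmb f₂ M₂ N ∧
        ∀ x ∈ M₀.carrier, f₁ x = x ∧ f₂ x = x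
  joint_embedding : ∀ {M₁ M₂ : Model L}, K.InF lam th M₁ → K.InF lam th M₂ →
    ∃ (N : Model L) (f₁ f₂ : ZFSet.{u} → ZFSet.{u}),
      K.InF lam th N ∧ K.IsEmb f₁ M₁ N ∧ K.IsEmb f₂ M₂ N
  no_maximal_models : ∀ {M : Model L}, K.InF lam th M →
    ∃ N, K.InF lam th N ∧ K.Prec M N ∧ M ≠ N
  density : ∀ {M N : Model L}, K.InF lam th M → K.InF lam th N → K.Prec M N → M ≠ N →
    ∃ a ∈ N.carrier, s.Basic M ![a] N
  existence : ∀ {M N : Model L} {m k : ℕ}, ∀ p ∈ s.bs M m, K.Prec M N → K.InF lam th N →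
    m ≤ k → (k : ℕ∞) < α → ∃ q ∈ s.bs N k, s.DoesNotFork q M ∧ q.Extends p
  uniqueness : ∀ {M N : Model L} {n : ℕ} (p q : GType K N n) (h : K.Prec M N), (n : ℕ∞) < α →
    s.DoesNotFork p M → s.DoesNotFork q M → p.restrict h le_rfl = q.restrict h le_rfl → p = q
  symmetry : ∀ {M₀ M₂ N : Model L} {m n : ℕ} {a₁ : Fin m → ZFSet.{u}} {a₂ : Fin n → ZFSet.{u}},
    s.nf M₀ M₂ a₁ N → (n : ℕ∞) < α → (∀ i, a₂ i ∈ M₂.carrier) → s.Basic M₀ a₂ N →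
      ∃ M₁ N', (∀ i, a₁ i ∈ M₁.carrier) ∧ K.Prec N N' ∧ s.nf M₀ M₁ a₂ N'
  local_character : ∀ {δ : Ordinal.{u}} {M : Ordinal.{u} → Model L} {n : ℕ},
    Order.IsSuccLimit δ → IncreasingContinuous K.Prec (Order.succ δ) M →
      (∀ i ≤ δ, K.InF lam th (M i)) → ∀ p ∈ s.bs (M δ) n, (n : Cardinal.{u}) < δ.cof →
        ∃ i < δ, s.DoesNotFork p (M i)
  continuity : ∀ {δ : Ordinal.{u}} {M : Ordinal.{u} → Model L} {ℓ : Ordinal.{u} → ℕ},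
    Order.IsSuccLimit δ → IncreasingContinuous K.Prec (Order.succ δ) M →
      (∀ i ≤ δ, K.InF lam th (M i)) → (∀ i ≤ δ, (ℓ i : ℕ∞) < α) →
      (∀ i j, i ≤ j → j ≤ δ → ℓ i ≤ ℓ j) →
      (∀ i ≤ δ, Order.IsSuccLimit i → IsLUB (ℓ '' Set.Iio i) (ℓ i)) →
      ∀ p : ∀ i, i < δ → GType K (M i) (ℓ i), (∀ i hi, p i hi ∈ s.bs (M i) (ℓ i)) →
        (∀ j i (hji : j < i) (hi : i < δ), (p i hi).Extends (p j (hji.trans hi))) →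
          ∃ q ∈ s.bs (M δ) (ℓ δ), (∀ i hi, q.Extends (p i hi)) ∧
            ((∀ i hi, s.DoesNotFork (p i hi) (M 0)) → s.DoesNotFork q (M 0))
  transitivity : ∀ {M₀ M₁ M₂ : Model L} {n : ℕ} (p : GType K M₂ n) (_ : K.Prec M₀ M₁)
    (h : K.Prec M₁ M₂), (n : ℕ∞) < α → s.DoesNotFork p M₁ →
      s.DoesNotFork (p.restrict h le_rfl) M₀ → s.DoesNotFork p M₀

/-- `s` is a good `(<α, 𝓕)`-frame, where `𝓕 = [lam, th)`. -/
structure IsGood (α : ℕ∞) (lam : Cardinal.{u}) (th : WithTop Cardinal.{u})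
    (s : FrameTriple K) : Prop extends IsGoodExceptStability α lam th s where
  bs_stability : ∀ {M : Model L}, K.InF lam th M →
    #(s.bs M 1) ≤ Cardinal.lift.{u + 1} M.size

/-- The sequence `a₀, …, aₙ₋₁` together with the chain `C₀ ≺ ⋯ ≺ Cₙ` is independent in
`(M, M', N)`. A finite chain has no limit indices, so continuity is automatic. -/
def FrameTriple.IndependentChain (s : FrameTriple K) (lam : Cardinal.{u})
    (th : WithTop Cardinal.{u}) {n : ℕ} (a : Fin n → ZFSet.{u}) (C : Fin (n + 1) → Model L)
    (M M' N : Model L) : Prop :=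
  (∀ i j, i ≤ j → K.Prec (C i) (C j)) ∧ (∀ i, K.InF lam th (C i)) ∧
    K.Prec M M' ∧ K.Prec M' (C 0) ∧ K.InF lam th M ∧ K.InF lam th M' ∧
    K.Prec (C (Fin.last n)) N ∧ K.InF lam th N ∧
    ∀ i : Fin n, s.nf M (C i.castSucc) ![a i] (C i.succ)

/-- The sequence `a₀, …, aₙ₋₁` is independent in `(M, M₀, N)`, that is, independent from `M₀` over
`M` in `N`. -/
def FrameTriple.Independent (s : FrameTriple K) (lam : Cardinal.{u}) (th : WithTop Cardinal.{u})
    {n : ℕ} (a : Fin n → ZFSet.{u}) (M M₀ N : Model L) : Prop :=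
  K.Prec M M₀ ∧ K.Prec M₀ N ∧ (∀ i, a i ∈ N.carrier) ∧
    ∃ (C : Fin (n + 1) → Model L) (N₁ : Model L), C 0 = M₀ ∧
      K.Prec (C (Fin.last n)) N₁ ∧ K.Prec N N₁ ∧
      s.IndependentChain lam th a C M (C 0) (C (Fin.last n))

/-- The elongation `s^{<α}` (for `α ≤ ω`): nonforking is being an independent sequence, and a type
is basic if it is realized by a sequence independent from its domain over its domain. -/
def FrameTriple.elongation (s : FrameTriple K) (α : ℕ∞) (lam : Cardinal.{u})
    (th : WithTop Cardinal.{u}) : FrameTriple K where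
  nf M₀ M₁ n a N := (n : ℕ∞) < α ∧ K.InF lam th M₀ ∧ K.InF lam th M₁ ∧ K.InF lam th N ∧
    s.Independent lam th a M₀ M₁ N
  bs M n := {p | (n : ℕ∞) < α ∧ K.InF lam th M ∧
    ∃ (a : Fin n → ZFSet.{u}) (N : Model L) (h : K.Prec M N) (ha : ∀ i, a i ∈ N.carrier),
      p = tp h ha ∧ K.InF lam th N ∧ s.Independent lam th a M M N}

end Frames

end GoodFrame

/-!
A sequence is independent from `M₁` over `M₀` when its members are added one at a time, each by a
type over the current model that does not fork over `M₀`. Nonforking extensions of 1-types can be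
taken along embeddings, so such a chain can be carried out over any model extending `M₁`; this gives
existence. Going up the chain, uniqueness for 1-types shows that the type of an independent sequence
over `M₁` is determined by the types of its members over `M₀`. Iterating symmetry for 1-types, two
consecutive independent sequences can be exchanged, which is symmetry for finite sequences.
Moreover a basic type of finite length does not fork over `M₀` as soon as the types of its members
do not, and this reduces local character to 1-types. In the continuity axiom the lengths are
eventually constant, so from some index on nothing forks over a fixed `M j`, and the limit type is
the nonforking extension of the type over `M j`.
-/

namespace GoodFrame

open FirstOrder Cardinal

/-! ### Isomorphisms and embeddings -/

section Isomorphisms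

variable {L : FirstOrder.Language.{u, u}} {M N P : Model L} {f g : ZFSet.{u} → ZFSet.{u}}

theorem IsIso.refl (M : Model L) : IsIso id M M := ⟨Language.Equiv.refl L _, fun _ => rfl⟩

theorem IsIso.congr (h : IsIso f M N) (hfg : ∀ x ∈ M.carrier, f x = g x) : IsIso g M N := by
  obtain ⟨e, he⟩ := h
  exact ⟨e, fun x => (he x).trans (hfg x x.2)⟩

theorem IsIso.of_fixed (h : ∀ x ∈ M.carrier, f x = x) : IsIso f M M :=
  (IsIso.refl M).congr fun x hx => (h x hx).symm

theorem IsIso.comp (hg : IsIso g N P) (hf : IsIso f M N) : IsIso (fun x => g (f x)) M P := by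
  obtain ⟨e, he⟩ := hf
  obtain ⟨e', he'⟩ := hg
  exact ⟨e'.comp e, fun x => by simp [he', he]⟩

theorem IsIso.mem (h : IsIso f M N) {x : ZFSet.{u}} (hx : x ∈ M.carrier) : f x ∈ N.carrier := by
  obtain ⟨e, he⟩ := h
  rw [← he ⟨x, hx⟩]
  exact (e _).2

theorem IsIso.injOn (h : IsIso f M N) : Set.InjOn f M.carrier := by
  obtain ⟨e, he⟩ := h
  intro x hx y hy hxy
  have : e ⟨x, hx⟩ = e ⟨y, hy⟩ := Subtype.ext (by rw [he, he]; exact hxy)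
  simpa using this

theorem IsIso.exists_symm (h : IsIso f M N) :
    ∃ g, IsIso g N M ∧ (∀ x ∈ M.carrier, g (f x) = x) ∧ ∀ y ∈ N.carrier, f (g y) = y := by
  classical
  obtain ⟨e, he⟩ := h
  refine ⟨fun y => if hy : y ∈ N.carrier then e.symm ⟨y, hy⟩ else y,
    ⟨e.symm, fun y => by simp⟩, fun x hx => ?_, fun y hy => ?_⟩
  · have : f x = e ⟨x, hx⟩ := (he ⟨x, hx⟩).symm
    simp [this]
  · simp only [hy, dite_true]
    rw [← he]
    simp

theorem exists_isIso_of_injOn (M : Model L) (hf : Set.InjOn f M.carrier) :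
    ∃ N, IsIso f M N := by
  let e : M.carrier ≃ f '' M.carrier := Equiv.Set.imageOfInjOn f M.carrier hf
  let i : L.Structure (f '' M.carrier) := e.inducedStructure
  exact ⟨⟨f '' M.carrier, small_image f M.carrier, i⟩, e.inducedStructureEquiv, fun _ => rfl⟩

theorem IsIso.size_eq (h : IsIso f M N) : M.size = N.size := by
  obtain ⟨e, -⟩ := h
  exact Cardinal.mk_congr ((equivShrink _).symm.trans (e.toEquiv.trans (equivShrink _)))

theorem exists_injective_forall_notMem (A : Set ZFSet.{u}) [Small.{u} A] :
    ∃ f : ZFSet.{u} → ZFSet.{u}, Function.Injective f ∧ ∀ x, f x ∉ A := by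
  let w : ZFSet.{u} := ZFSet.range (fun x : Shrink.{u} A => ((equivShrink A).symm x : ZFSet.{u}))
  refine ⟨fun x => ZFSet.pair x w, fun x y h => (ZFSet.pair_inj.1 h).1, fun x hx => ?_⟩
  have pair_mem : ZFSet.pair x w ∈ w := ZFSet.mem_range.2 ⟨equivShrink A ⟨_, hx⟩, by simp⟩
  have mem_doubleton : w ∈ ({x, w} : ZFSet.{u}) := by simp
  have doubleton_mem : ({x, w} : ZFSet.{u}) ∈ ZFSet.pair x w := by simp [ZFSet.pair]
  have rank_lt_pair : w.rank < (ZFSet.pair x w).rank :=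
    (ZFSet.rank_lt_of_mem mem_doubleton).trans (ZFSet.rank_lt_of_mem doubleton_mem)
  exact rank_lt_pair.not_gt (ZFSet.rank_lt_of_mem pair_mem)

theorem IsIso.exists_extend (h : IsIso f M N) (P : Model L) :
    ∃ (g : ZFSet.{u} → ZFSet.{u}) (Q : Model L), IsIso g P Q ∧ ∀ x ∈ M.carrier, g x = f x := by
  classical
  obtain ⟨φ, hφ, hφN⟩ := exists_injective_forall_notMem N.carrier
  let g : ZFSet.{u} → ZFSet.{u} := fun x => if x ∈ M.carrier then f x else φ x
  have hg : Set.InjOn g P.carrier := by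
    intro x _ y _ hxy
    by_cases hx : x ∈ M.carrier <;> by_cases hy : y ∈ M.carrier
    · simp only [g, hx, hy, if_true] at hxy
      exact h.injOn hx hy hxy
    · simp only [g, hx, hy, if_true, if_false] at hxy
      exact absurd (hxy ▸ h.mem hx) (hφN y)
    · simp only [g, hx, hy, if_true, if_false] at hxy
      exact absurd (hxy ▸ h.mem hy) (hφN x)
    · simp only [g, hx, hy, if_false] at hxy
      exact hφ hxy
  obtain ⟨Q, hQ⟩ := exists_isIso_of_injOn P hg
  exact ⟨g, Q, hQ, fun x hx => by simp [g, hx]⟩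

theorem Model.IsSubstructure.subset (h : M.IsSubstructure N) : M.carrier ⊆ N.carrier := by
  obtain ⟨e, he⟩ := h
  intro x hx
  rw [← show (e ⟨x, hx⟩ : ZFSet.{u}) = x from he ⟨x, hx⟩]
  exact (e _).2

theorem Model.IsSubstructure.of_subset (hM : M.IsSubstructure P) (hN : N.IsSubstructure P)
    (h : M.carrier ⊆ N.carrier) : M.IsSubstructure N := by
  obtain ⟨e, he⟩ := hM
  obtain ⟨e', he'⟩ := hN
  have incl_eq : ∀ x : M.carrier, e' (Set.inclusion h x) = e x := fun x =>
    Subtype.ext (by rw [he', he])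
  have comp_eq : ∀ {n : ℕ} (x : Fin n → M.carrier), e' ∘ (Set.inclusion h ∘ x) = e ∘ x :=
    fun x => funext fun i => incl_eq (x i)
  refine ⟨⟨⟨Set.inclusion h, Set.inclusion_injective h⟩, fun F x => ?_, fun R x => ?_⟩,
    fun _ => rfl⟩
  · apply e'.injective
    rw [e'.map_fun]
    exact (incl_eq _).trans ((e.map_fun F x).trans (congrArg _ (comp_eq x).symm))
  · change Language.Structure.RelMap R (Set.inclusion h ∘ x) ↔ _
    rw [← e'.map_rel, ← e.map_rel, comp_eq]

end Isomorphisms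

namespace AEC

section Embeddings

variable {L : FirstOrder.Language.{u, u}} {K : AEC L} {M M' N N' P : Model L}
  {f g : ZFSet.{u} → ZFSet.{u}}

theorem Prec.subset (h : K.Prec M N) : M.carrier ⊆ N.carrier := (K.isSubstructure h).subset

theorem Prec.of_subset (hM : K.Prec M P) (hN : K.Prec N P) (h : M.carrier ⊆ N.carrier) :
    K.Prec M N :=
  K.coherence hM hN ((K.isSubstructure hM).of_subset (K.isSubstructure hN) h)

theorem Prec.exists_image (h : K.Prec M N) (hf : IsIso f N N') :
    ∃ M', IsIso f M M' ∧ K.Prec M' N' := by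
  obtain ⟨M', hM'⟩ := exists_isIso_of_injOn M (hf.injOn.mono h.subset)
  exact ⟨M', hM', K.prec_iso h hM' hf⟩

theorem Prec.exists_extend (h : K.Prec M N) (hf : IsIso f M M') :
    ∃ g N', IsIso g N N' ∧ K.Prec M' N' ∧ ∀ x ∈ M.carrier, g x = f x := by
  obtain ⟨g, N', hg, hgf⟩ := hf.exists_extend N
  exact ⟨g, N', hg, K.prec_iso h (hf.congr fun x hx => (hgf x hx).symm) hg, hgf⟩

theorem IsEmb.of_prec (h : K.Prec M N) : K.IsEmb id M N := ⟨M, IsIso.refl M, h⟩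

theorem IsEmb.of_isIso (h : IsIso f M N) (hN : K.Mem N) : K.IsEmb f M N := ⟨N, h, K.refl hN⟩

theorem IsEmb.mem (h : K.IsEmb f M N) {x : ZFSet.{u}} (hx : x ∈ M.carrier) : f x ∈ N.carrier := by
  obtain ⟨R, hR, hRN⟩ := h
  exact hRN.subset (hR.mem hx)

theorem IsEmb.injOn (h : K.IsEmb f M N) : Set.InjOn f M.carrier := by
  obtain ⟨R, hR, -⟩ := h
  exact hR.injOn

theorem IsEmb.trans_prec (hf : K.IsEmb f M N) (h : K.Prec N P) : K.IsEmb f M P := by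
  obtain ⟨R, hR, hRN⟩ := hf
  exact ⟨R, hR, K.trans hRN h⟩

theorem IsEmb.restrict (hf : K.IsEmb f N P) (h : K.Prec M N) : K.IsEmb f M P := by
  obtain ⟨R, hR, hRN⟩ := hf
  obtain ⟨R', hR', hRS⟩ := h.exists_image hR
  exact ⟨R', hR', K.trans hRS hRN⟩

theorem IsEmb.comp (hg : K.IsEmb g N P) (hf : K.IsEmb f M N) :
    K.IsEmb (fun x => g (f x)) M P := by
  obtain ⟨R, hR, hRN⟩ := hf
  obtain ⟨R', hR', hRP⟩ := hg.restrict hRN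
  exact ⟨R', hR'.comp hR, hRP⟩

theorem IsEmb.exists_prec (hf : K.IsEmb f M N) :
    ∃ g N', IsIso g N N' ∧ K.Prec M N' ∧ ∀ x ∈ M.carrier, g (f x) = x := by
  obtain ⟨R, hR, hRN⟩ := hf
  obtain ⟨k, hk, hkf, -⟩ := hR.exists_symm
  obtain ⟨g, N', hg, hN', hgk⟩ := hRN.exists_extend hk
  exact ⟨g, N', hg, hN', fun x hx => (hgk _ (hR.mem hx)).trans (hkf x hx)⟩

end Embeddings

section Cardinality

variable {L : FirstOrder.Language.{u, u}} {K : AEC L} {M M' N P : Model L}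
  {lam : Cardinal.{u}} {th : WithTop Cardinal.{u}}

theorem lift_size (M : Model L) : Cardinal.lift.{u + 1} M.size = #M.carrier := by
  simpa [Model.size] using Cardinal.lift_id'.{u, u + 1} _

theorem Prec.size_le (h : K.Prec M N) : M.size ≤ N.size := by
  rw [← Cardinal.lift_le.{u + 1}, lift_size, lift_size]
  exact Cardinal.mk_le_mk_of_subset h.subset

theorem InF.of_isIso {f : ZFSet.{u} → ZFSet.{u}} (hM : K.InF lam th M) (h : IsIso f M N) :
    K.InF lam th N :=
  ⟨K.mem_iso hM.1 h, h.size_eq ▸ hM.2.1, h.size_eq ▸ hM.2.2⟩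

theorem InF.of_between (hM : K.InF lam th M) (hP : K.InF lam th P) (hMN : K.Prec M N)
    (hNP : K.Prec N P) : K.InF lam th N :=
  ⟨(K.mem_of_prec hMN).2, hM.2.1.trans hMN.size_le,
    (WithTop.coe_le_coe.2 hNP.size_le).trans_lt hP.2.2⟩

theorem lowenheimSkolem_LS (K : AEC L) : LowenheimSkolem K.Mem K.Prec K.LS :=
  csInf_mem (s := {κ | LowenheimSkolem K.Mem K.Prec κ}) K.exists_lowenheimSkolem

theorem InF.aleph0_le (hM : K.InF lam th M) (hLS : K.LS ≤ lam) : ℵ₀ ≤ #M.carrier := by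
  rw [← lift_size, Cardinal.aleph0_le_lift]
  exact K.lowenheimSkolem_LS.1.trans (hLS.trans hM.2.1)

theorem InF.exists_prec_of_mk_le (hLS : K.LS ≤ lam) (hM : K.InF lam th M) (hP : K.InF lam th P)
    (hN : K.Mem N) {A : Set ZFSet.{u}} (hMA : M.carrier ⊆ A) (hAN : A ⊆ N.carrier)
    (hA : #A ≤ #P.carrier) : ∃ N₀, K.InF lam th N₀ ∧ K.Prec N₀ N ∧ A ⊆ N₀.carrier := by
  obtain ⟨N₀, hN₀, hAN₀, size_le⟩ := K.lowenheimSkolem_LS.2.2 N hN A hAN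
  have size_le_size : N₀.size ≤ P.size := by
    rw [← Cardinal.lift_le.{u + 1}, lift_size P]
    refine size_le.trans (Cardinal.add_le_of_le (hP.aleph0_le hLS) hA ?_)
    rw [← lift_size]
    exact Cardinal.lift_le.2 (hLS.trans hP.2.1)
  refine ⟨N₀, ⟨(K.mem_of_prec hN₀).1, hM.2.1.trans ?_, ?_⟩, hN₀, hAN₀⟩
  · rw [← Cardinal.lift_le.{u + 1}, lift_size, lift_size]
    exact Cardinal.mk_le_mk_of_subset (hMA.trans hAN₀)
  · exact (WithTop.coe_le_coe.2 size_le_size).trans_lt hP.2.2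

theorem InF.exists_prec_of_tuple (hLS : K.LS ≤ lam) (hM : K.InF lam th M) (hMN : K.Prec M N)
    {n : ℕ} {a : Fin n → ZFSet.{u}} (ha : ∀ i, a i ∈ N.carrier) :
    ∃ N₀, K.InF lam th N₀ ∧ K.Prec N₀ N ∧ K.Prec M N₀ ∧ ∀ i, a i ∈ N₀.carrier := by
  have hinf := hM.aleph0_le hLS
  have mk_le : #↥(M.carrier ∪ Set.range a) ≤ #M.carrier :=
    (Cardinal.mk_union_le _ _).trans (Cardinal.add_le_of_le hinf le_rfl
      ((Set.finite_range a).lt_aleph0.le.trans hinf))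
  obtain ⟨N₀, hN₀, hN₀N, hsub⟩ := hM.exists_prec_of_mk_le hLS hM (K.mem_of_prec hMN).2
    Set.subset_union_left (Set.union_subset hMN.subset (Set.range_subset_iff.2 ha)) mk_le
  exact ⟨N₀, hN₀, hN₀N, hMN.of_subset hN₀N (Set.subset_union_left.trans hsub),
    fun i => hsub (Or.inr ⟨i, rfl⟩)⟩

theorem InF.exists_prec_of_prec (hLS : K.LS ≤ lam) (hM : K.InF lam th M) (hM' : K.InF lam th M')
    (hMN : K.Prec M N) (hMN' : K.Prec M' N) :
    ∃ N₀, K.InF lam th N₀ ∧ K.Prec N₀ N ∧ K.Prec M N₀ ∧ K.Prec M' N₀ := by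
  wlog h : M.size ≤ M'.size generalizing M M'
  · obtain ⟨N₀, hN₀, hN₀N, hM'N₀, hMN₀⟩ := this hM' hM hMN' hMN (le_of_not_ge h)
    exact ⟨N₀, hN₀, hN₀N, hMN₀, hM'N₀⟩
  have mk_le : #↥(M.carrier ∪ M'.carrier) ≤ #M'.carrier :=
    (Cardinal.mk_union_le _ _).trans (Cardinal.add_le_of_le (hM'.aleph0_le hLS)
      (by rwa [← lift_size, ← lift_size, Cardinal.lift_le]) le_rfl)
  obtain ⟨N₀, hN₀, hN₀N, hsub⟩ := hM.exists_prec_of_mk_le hLS hM' (K.mem_of_prec hMN).2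
    Set.subset_union_left (Set.union_subset hMN.subset hMN'.subset) mk_le
  exact ⟨N₀, hN₀, hN₀N, hMN.of_subset hN₀N (Set.subset_union_left.trans hsub),
    hMN'.of_subset hN₀N (Set.subset_union_right.trans hsub)⟩

end Cardinality

end AEC

/-! ### Galois types -/

section GaloisTypes

variable {L : FirstOrder.Language.{u, u}} {K : AEC L} {M M₀ M₁ N N' N'' P P' : Model L}
  {f : ZFSet.{u} → ZFSet.{u}} {lam : Cardinal.{u}} {th : WithTop Cardinal.{u}} {m n : ℕ}
  {a b c : Fin n → ZFSet.{u}}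

namespace AEC

variable (K lam th) in
/-- The amalgamation property of `K_𝓕`. -/
def HasAmalgamation : Prop :=
  ∀ ⦃M N P : Model L⦄, K.InF lam th M → K.InF lam th N → K.InF lam th P →
    K.Prec M N → K.Prec M P → ∃ (Q : Model L) (f g : ZFSet.{u} → ZFSet.{u}),
      K.InF lam th Q ∧ K.IsEmb f N Q ∧ K.IsEmb g P Q ∧ ∀ x ∈ M.carrier, f x = x ∧ g x = x

variable (K lam th) in
/-- The tuples `a` from `N` and `b` from `N'` are identified by embeddings of `N` and `N'` over `M`
into a model in `K_𝓕`. With amalgamation, for models in `K_𝓕`, this is equality of the Galois types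
`tp(a / M; N)` and `tp(b / M; N')`. -/
def SameType (M : Model L) (a : Fin n → ZFSet.{u}) (N : Model L) (b : Fin n → ZFSet.{u})
    (N' : Model L) : Prop :=
  ∃ (R : Model L) (f g : ZFSet.{u} → ZFSet.{u}), K.InF lam th R ∧ K.IsEmb f N R ∧
    K.IsEmb g N' R ∧ (∀ x ∈ M.carrier, f x = x ∧ g x = x) ∧ ∀ i, f (a i) = g (b i)

namespace SameType

theorem symm (h : K.SameType lam th M a N b N') : K.SameType lam th M b N' a N := by
  obtain ⟨R, f, g, hR, hf, hg, hM, hab⟩ := h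
  exact ⟨R, g, f, hR, hg, hf, fun x hx => (hM x hx).symm, fun i => (hab i).symm⟩

theorem of_isEmb (hf : K.IsEmb f N N') (hN' : K.InF lam th N') (hM : ∀ x ∈ M.carrier, f x = x)
    (hab : ∀ i, f (a i) = b i) : K.SameType lam th M a N b N' :=
  ⟨N', f, id, hN', hf, IsEmb.of_prec (K.refl hN'.1), fun x hx => ⟨hM x hx, rfl⟩, hab⟩

theorem mono (h : K.SameType lam th M a N b N') (hP : K.Prec P N) (hP' : K.Prec P' N') :
    K.SameType lam th M a P b P' := by
  obtain ⟨R, f, g, hR, hf, hg, hM, hab⟩ := h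
  exact ⟨R, f, g, hR, hf.restrict hP, hg.restrict hP', hM, hab⟩

theorem comp (h : K.SameType lam th M a N b N') (e : Fin m → Fin n) :
    K.SameType lam th M (a ∘ e) N (b ∘ e) N' := by
  obtain ⟨R, f, g, hR, hf, hg, hM, hab⟩ := h
  exact ⟨R, f, g, hR, hf, hg, hM, fun i => hab (e i)⟩

theorem exists_prec (h : K.SameType lam th M a N b N') (hMN : K.Prec M N)
    (ha : ∀ i, a i ∈ N.carrier) :
    ∃ R g, K.InF lam th R ∧ K.Prec N R ∧ K.IsEmb g N' R ∧ (∀ x ∈ M.carrier, g x = x) ∧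
      ∀ i, g (b i) = a i := by
  obtain ⟨R, f, g, hR, hf, hg, hM, hab⟩ := h
  obtain ⟨k, R', hk, hNR', hkf⟩ := hf.exists_prec
  have hR' := hR.of_isIso hk
  refine ⟨R', fun x => k (g x), hR', hNR', (IsEmb.of_isIso hk hR'.1).comp hg, fun x hx => ?_,
    fun i => ?_⟩
  · have hfg : g x = f x := (hM x hx).2.trans (hM x hx).1.symm
    exact (congrArg k hfg).trans (hkf x (hMN.subset hx))
  · exact (congrArg k (hab i).symm).trans (hkf _ (ha i))

theorem tp_eq (h : K.SameType lam th M a N b N') (hN : K.Prec M N) (hN' : K.Prec M N')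
    (ha : ∀ i, a i ∈ N.carrier) (hb : ∀ i, b i ∈ N'.carrier) : tp hN ha = tp hN' hb := by
  obtain ⟨R, f, g, -, hf, hg, hM, hab⟩ := h
  exact Quot.sound ⟨R, f, g, hf, hg, hM, hab⟩

end SameType

namespace HasAmalgamation

variable (hAP : K.HasAmalgamation lam th)
include hAP

theorem sameType_zero (hM : K.InF lam th M) (hN : K.InF lam th N) (hP : K.InF lam th P)
    (hMN : K.Prec M N) (hMP : K.Prec M P) (a b : Fin 0 → ZFSet.{u}) :
    K.SameType lam th M a N b P := by
  obtain ⟨Q, f, g, hQ, hf, hg, hfg⟩ := hAP hM hN hP hMN hMP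
  exact ⟨Q, f, g, hQ, hf, hg, hfg, fun i => i.elim0⟩

theorem exists_prec (hM : K.InF lam th M) (hN : K.InF lam th N) (hP : K.InF lam th P)
    (hMN : K.Prec M N) (hMP : K.Prec M P) :
    ∃ Q g, K.InF lam th Q ∧ K.Prec N Q ∧ K.IsEmb g P Q ∧ ∀ x ∈ M.carrier, g x = x := by
  obtain ⟨Q, g, hQ, hNQ, hg, hgM, -⟩ :=
    (hAP.sameType_zero hM hN hP hMN hMP Fin.elim0 Fin.elim0).exists_prec hMN fun i => i.elim0
  exact ⟨Q, g, hQ, hNQ, hg, hgM⟩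

theorem sameType_trans (hN' : K.InF lam th N') (hMN' : K.Prec M N') (hb : ∀ i, b i ∈ N'.carrier)
    (hab : K.SameType lam th M a N b N') (hbc : K.SameType lam th M b N' c N'') :
    K.SameType lam th M a N c N'' := by
  obtain ⟨R, f, hR, hN'R, hf, hfM, hfa⟩ := hab.symm.exists_prec hMN' hb
  obtain ⟨S, g, hS, hN'S, hg, hgM, hgc⟩ := hbc.exists_prec hMN' hb
  obtain ⟨Q, k, hQ, hRQ, hk, hkN'⟩ := hAP.exists_prec hN' hR hS hN'R hN'S
  refine ⟨Q, f, fun x => k (g x), hQ, hf.trans_prec hRQ, hk.comp hg, fun x hx => ⟨hfM x hx, ?_⟩,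
    fun i => ?_⟩
  · exact (congrArg k (hgM x hx)).trans (hkN' x (hMN'.subset hx))
  · exact (hfa i).trans (((congrArg k (hgc i)).trans (hkN' _ (hb i))).symm)

theorem sameType_of_eqvGen (hLS : K.LS ≤ lam) (hM : K.InF lam th M) {p q : Realization K M n}
    (h : Relation.EqvGen Realization.AtomicEq p q) {p₀ q₀ : Model L} (hp₀ : K.InF lam th p₀)
    (hq₀ : K.InF lam th q₀) (hMp : K.Prec M p₀) (hMq : K.Prec M q₀) (hp : K.Prec p₀ p.ambient)
    (hq : K.Prec q₀ q.ambient) (hpt : ∀ i, p.tuple i ∈ p₀.carrier)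
    (hqt : ∀ i, q.tuple i ∈ q₀.carrier) : K.SameType lam th M p.tuple p₀ q.tuple q₀ := by
  induction h generalizing p₀ q₀ with
  | rel p q h =>
    obtain ⟨N, f, g, hf, hg, hfg, hi⟩ := h
    obtain ⟨R, hR, hRN⟩ := hf.restrict hp
    obtain ⟨S, hS, hSN⟩ := hg.restrict hq
    obtain ⟨N₀, hN₀, -, hRN₀, hSN₀⟩ :=
      (hp₀.of_isIso hR).exists_prec_of_prec hLS (hq₀.of_isIso hS) hRN hSN
    exact ⟨N₀, f, g, hN₀, ⟨R, hR, hRN₀⟩, ⟨S, hS, hSN₀⟩, hfg, hi⟩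
  | refl p =>
    obtain ⟨N₀, hN₀, -, hpN₀, hqN₀⟩ := hp₀.exists_prec_of_prec hLS hq₀ hp hq
    exact ⟨N₀, id, id, hN₀, IsEmb.of_prec hpN₀, IsEmb.of_prec hqN₀, fun _ _ => ⟨rfl, rfl⟩,
      fun _ => rfl⟩
  | symm p q _ ih => exact (ih hq₀ hp₀ hMq hMp hq hp hqt hpt).symm
  | trans p r q _ _ ih ih' =>
    obtain ⟨r₀, hr₀, hr, hMr, hrt⟩ := hM.exists_prec_of_tuple hLS r.prec r.mem
    exact hAP.sameType_trans hr₀ hMr hrt (ih hp₀ hr₀ hMp hMr hp hr hpt hrt)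
      (ih' hr₀ hq₀ hMr hMq hr hq hrt hqt)

theorem sameType_of_tp_eq (hLS : K.LS ≤ lam) (hM : K.InF lam th M) (hN : K.InF lam th N)
    (hN' : K.InF lam th N') {h : K.Prec M N} {h' : K.Prec M N'} {ha : ∀ i, a i ∈ N.carrier}
    {hb : ∀ i, b i ∈ N'.carrier} (heq : tp h ha = tp h' hb) : K.SameType lam th M a N b N' :=
  hAP.sameType_of_eqvGen hLS hM (Quot.eqvGen_exact heq) hN hN' h h' (K.refl hN.1) (K.refl hN'.1)
    ha hb

end HasAmalgamation

end AEC

open AEC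

theorem tp_eq_of_isEmb (hf : K.IsEmb f N N') (hM : ∀ x ∈ M.carrier, f x = x)
    (hab : ∀ i, f (a i) = b i) (hMN : K.Prec M N) (hMN' : K.Prec M N') (ha : ∀ i, a i ∈ N.carrier)
    (hb : ∀ i, b i ∈ N'.carrier) : tp hMN ha = tp hMN' hb :=
  Quot.sound ⟨N', f, id, hf, IsEmb.of_prec (K.refl (K.mem_of_prec hMN').2),
    fun x hx => ⟨hM x hx, rfl⟩, hab⟩

theorem tp_eq_of_prec (hN : K.Prec N N') (hMN : K.Prec M N) (hMN' : K.Prec M N')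
    (ha : ∀ i, a i ∈ N.carrier) (ha' : ∀ i, a i ∈ N'.carrier) : tp hMN ha = tp hMN' ha' :=
  tp_eq_of_isEmb (IsEmb.of_prec hN) (fun _ _ => rfl) (fun _ => rfl) _ _ _ _

theorem Realization.AtomicEq.symm {r r' : Realization K M n} (h : r.AtomicEq r') :
    r'.AtomicEq r := by
  obtain ⟨N, f, g, hf, hg, hfg, hi⟩ := h
  exact ⟨N, g, f, hg, hf, fun x hx => (hfg x hx).symm, fun i => (hi i).symm⟩

theorem Realization.AtomicEq.notMem {r r' : Realization K M n} (h : r.AtomicEq r')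
    (hr : ∀ i, r.tuple i ∉ M.carrier) (i : Fin n) : r'.tuple i ∉ M.carrier := by
  obtain ⟨N, f, g, hf, -, hfg, hi⟩ := h
  intro hM
  have f_tuple_eq : f (r.tuple i) = f (r'.tuple i) := by
    rw [hi, (hfg _ hM).2, (hfg _ hM).1]
  exact hr i (hf.injOn (r.mem i) (r.prec.subset hM) f_tuple_eq ▸ hM)

namespace GType

theorem Nonalgebraic.notMem {h : K.Prec M N} {ha : ∀ i, a i ∈ N.carrier}
    (hp : (tp h ha).Nonalgebraic) (i : Fin n) : a i ∉ M.carrier := by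
  obtain ⟨r, hr, hrM⟩ := hp
  have notMem_iff := congrArg (Quot.lift (fun r : Realization K M n => ∀ i, r.tuple i ∉ M.carrier)
    fun _ _ h => propext ⟨h.notMem, h.symm.notMem⟩) hr
  exact notMem_iff.mp hrM i

theorem restrict_refl (p : GType K M n) (h : K.Prec M M) : p.restrict h le_rfl = p := by
  induction p using Quot.ind
  rfl

theorem restrict_restrict {k : ℕ} (p : GType K N n) (h : K.Prec M N) (h' : K.Prec M₀ M)
    (hm : m ≤ n) (hk : k ≤ m) :
    (p.restrict h hm).restrict h' hk = p.restrict (K.trans h' h) (hk.trans hm) := by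
  induction p using Quot.ind
  rfl

theorem Extends.refl (p : GType K M n) (hM : K.Mem M) : p.Extends p :=
  ⟨K.refl hM, le_rfl, p.restrict_refl _⟩

theorem Extends.trans {k : ℕ} {p : GType K M₀ k} {q : GType K M m} {r : GType K N n}
    (hrq : r.Extends q) (hqp : q.Extends p) : r.Extends p := by
  obtain ⟨h, hm, rfl⟩ := hrq
  obtain ⟨h', hm', rfl⟩ := hqp
  exact ⟨K.trans h' h, hm'.trans hm, (r.restrict_restrict _ _ _ _).symm⟩

theorem Extends.restrict {k : ℕ} {p : GType K M₀ k} {q : GType K N n} (hqp : q.Extends p)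
    (h : K.Prec M N) (h' : K.Prec M₀ M) (hm : m ≤ n) (hk : k ≤ m) :
    (q.restrict h hm).Extends p := by
  obtain ⟨_, _, rfl⟩ := hqp
  exact ⟨h', hk, q.restrict_restrict h h' hm hk⟩

/-- The type of the member with index `k` of a sequence realizing `p`. -/
def coord (p : GType K M n) (k : ℕ) (hk : k < n) : GType K M 1 :=
  Quot.map
    (fun r : Realization K M n =>
      (⟨r.ambient, r.prec, ![r.tuple ⟨k, hk⟩], Fin.forall_fin_one.2 (r.mem _)⟩ :
        Realization K M 1))
    (fun _ _ ⟨N, f, g, hf, hg, hfg, hi⟩ =>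
      ⟨N, f, g, hf, hg, hfg, Fin.forall_fin_one.2 (hi _)⟩) p

theorem coord_restrict (p : GType K M n) (h : K.Prec M₀ M) (hm : m ≤ n) (k : ℕ) (hk : k < m) :
    (p.restrict h hm).coord k hk = (p.coord k (hk.trans_le hm)).restrict h le_rfl := by
  induction p using Quot.ind
  rfl

theorem Extends.coord {p : GType K M₀ m} {q : GType K M₁ n} (hqp : q.Extends p) {k : ℕ}
    (hk : k < m) (hk' : k < n) : (q.coord k hk').Extends (p.coord k hk) := by
  obtain ⟨h, hm, rfl⟩ := hqp
  exact ⟨h, le_rfl, (q.coord_restrict h hm k hk).symm⟩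

end GType

end GaloisTypes

/-! ### Nonforking -/

section Nonforking

open AEC

variable {L : FirstOrder.Language.{u, u}} {K : AEC L} {M M₀ M₀' M₁ M₁' M₂ N N' P C C' D : Model L}
  {f f' : ZFSet.{u} → ZFSet.{u}} {lam : Cardinal.{u}} {th : WithTop Cardinal.{u}}
  {s : FrameTriple K} {α : ℕ∞} {m n : ℕ} {a b : Fin n → ZFSet.{u}}

namespace IsPreFrame

variable (hs : IsPreFrame α lam th s)
include hs

theorem nf_base (h : s.nf M₀ M₁ a N) (h₀ : K.Prec M₀ M₀') (h₁ : K.Prec M₀' M₁')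
    (h₂ : K.Prec M₁' M₁) : s.nf M₀' M₁' a N := by
  obtain ⟨-, -, hN, -, h₃, ha, -⟩ := hs.nf_domain h
  have hNN := K.refl hN.1
  exact (hs.nf_monotonicity (RelEmbedding.refl _) h h₀ h₁ h₂ h₃ hNN hNN hN ha).1

theorem nf_up (h : s.nf M₀ M₁ a N) (hN : K.Prec N P) (hP : K.InF lam th P) : s.nf M₀ M₁ a P := by
  obtain ⟨h₀, h₁, hN', h₂, h₃, ha, -⟩ := hs.nf_domain h
  exact (hs.nf_monotonicity (RelEmbedding.refl _) h (K.refl h₀.1) h₂ (K.refl h₁.1) h₃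
    (K.refl hN'.1) hN hP ha).2

theorem nf_down (h : s.nf M₀ M₁ a P) (hN : K.Prec N P) (hMN : K.Prec M₁ N)
    (ha : ∀ i, a i ∈ N.carrier) : s.nf M₀ M₁ a N := by
  obtain ⟨h₀, h₁, hP, h₂, -⟩ := hs.nf_domain h
  exact (hs.nf_monotonicity (RelEmbedding.refl _) h (K.refl h₀.1) h₂ (K.refl h₁.1) hMN
    hN (K.refl hP.1) hP ha).1

theorem nf_iso (h : s.nf M₀ M₁ a N) (h₀ : IsIso f M₀ M₀') (h₁ : IsIso f M₁ M₁')
    (hN : IsIso f N N') (hab : ∀ i, f (a i) = b i) : s.nf M₀' M₁' b N' :=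
  funext hab ▸ hs.nf_invariance hN h₀ h₁ h

theorem nf_emb (h : s.nf M₀ M₁ a N) (hf : K.IsEmb f N P) (hP : K.InF lam th P)
    (hM : ∀ x ∈ M₁.carrier, f x = x) (hab : ∀ i, f (a i) = b i) : s.nf M₀ M₁ b P := by
  obtain ⟨-, -, -, h₀₁, -⟩ := hs.nf_domain h
  obtain ⟨R, hR, hRP⟩ := hf
  exact hs.nf_up (hs.nf_iso h (IsIso.of_fixed fun x hx => hM x (h₀₁.subset hx))
    (IsIso.of_fixed hM) hR hab) hRP hP

theorem nf_of_sameType (h : s.nf M₀ M₁ b N') (hN : K.Prec M₁ N) (ha : ∀ i, a i ∈ N.carrier)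
    (hab : K.SameType lam th M₁ a N b N') : s.nf M₀ M₁ a N := by
  obtain ⟨R, g, hR, hNR, hg, hgM, hgb⟩ := hab.exists_prec hN ha
  exact hs.nf_down (hs.nf_emb h hg hR hgM hgb) hNR hN ha

theorem doesNotFork_tp_iff (hAP : K.HasAmalgamation lam th) (hN : K.InF lam th N)
    {h : K.Prec M₁ N} {ha : ∀ i, a i ∈ N.carrier} :
    s.DoesNotFork (tp h ha) M₀ ↔ s.nf M₀ M₁ a N := by
  refine ⟨?_, fun hnf => ⟨a, N, h, ha, rfl, hnf⟩⟩
  rintro ⟨b, N', h', hb, heq, hnf⟩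
  obtain ⟨-, h₁, hN', -⟩ := hs.nf_domain hnf
  exact hs.nf_of_sameType hnf h ha (hAP.sameType_of_tp_eq hs.ls_le h₁ hN hN' heq)

theorem doesNotFork_base {p : GType K M₁ n} (hp : s.DoesNotFork p M₀) (h : K.Prec M₀ M₀')
    (h' : K.Prec M₀' M₁) : s.DoesNotFork p M₀' := by
  obtain ⟨a, N, h₁, ha, rfl, hnf⟩ := hp
  exact ⟨a, N, h₁, ha, rfl, hs.nf_base hnf h h' (K.refl (K.mem_of_prec h').2)⟩

theorem doesNotFork_restrict {p : GType K M₁ n} (hp : s.DoesNotFork p M₀) (h : K.Prec M₀ M₁')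
    (h' : K.Prec M₁' M₁) (hm : m ≤ n) : s.DoesNotFork (p.restrict h' hm) M₀ := by
  obtain ⟨a, N, h₁, ha, rfl, hnf⟩ := hp
  obtain ⟨h₀, -, hN, -⟩ := hs.nf_domain hnf
  have hNN := K.refl hN.1
  exact ⟨_, N, K.trans h' h₁, fun i => ha _, rfl,
    (hs.nf_monotonicity (Fin.castLEOrderEmb hm) hnf (K.refl h₀.1) h h' h₁ hNN hNN hN
      fun i => ha _).1⟩

end IsPreFrame

namespace IsGoodExceptStability

variable (hs : IsGoodExceptStability α lam th s)
include hs

theorem hasAmalgamation : K.HasAmalgamation lam th := fun _ _ _ => hs.amalgamation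

theorem nf_trans (h : s.nf M₁ M₂ a N) (h' : s.nf M₀ M₁ a N) : s.nf M₀ M₂ a N := by
  obtain ⟨-, -, hN, h₁₂, h₂N, ha, hn⟩ := hs.nf_domain h
  obtain ⟨-, -, -, h₀₁, h₁N, -⟩ := hs.nf_domain h'
  exact (hs.doesNotFork_tp_iff hs.hasAmalgamation hN (h := h₂N) (ha := ha)).1
    (hs.transitivity _ h₀₁ h₁₂ hn ⟨a, N, h₂N, ha, rfl, h⟩ ⟨a, N, h₁N, ha, rfl, h'⟩)

theorem sameType_of_nf (h : s.nf M₀ M₁ a N) (h' : s.nf M₀ M₁ b N')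
    (hab : K.SameType lam th M₀ a N b N') : K.SameType lam th M₁ a N b N' := by
  obtain ⟨-, h₁, hN, h₀₁, h₁N, ha, hn⟩ := hs.nf_domain h
  obtain ⟨-, -, hN', -, h₁N', hb, -⟩ := hs.nf_domain h'
  exact hs.hasAmalgamation.sameType_of_tp_eq hs.ls_le h₁ hN hN'
    (hs.uniqueness (tp h₁N ha) (tp h₁N' hb) h₀₁ hn ⟨a, N, h₁N, ha, rfl, h⟩
      ⟨b, N', h₁N', hb, rfl, h'⟩ (hab.tp_eq _ _ _ _))

theorem doesNotFork_of_mem_bs {p : GType K M n} (hp : p ∈ s.bs M n) : s.DoesNotFork p M := by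
  obtain ⟨hM, hn, -⟩ := hs.bs_subset p hp
  obtain ⟨q, -, hq, _, _, rfl⟩ := hs.existence p hp (K.refl hM.1) hM le_rfl hn
  rwa [q.restrict_refl]

theorem nf_of_basic (hN : K.InF lam th N) (h : s.Basic M a N) : s.nf M M a N := by
  obtain ⟨_, _, hbs⟩ := h
  exact (hs.doesNotFork_tp_iff hs.hasAmalgamation hN).1 (hs.doesNotFork_of_mem_bs hbs)

theorem exists_nf (hM : K.InF lam th M) : ∃ x N, s.nf M M ![x] N := by
  obtain ⟨N, hN, hMN, hne⟩ := hs.no_maximal_models hM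
  obtain ⟨x, -, hx⟩ := hs.density hM hN hMN hne
  exact ⟨x, N, hs.nf_of_basic hN hx⟩

theorem exists_nf_extension_of_prec (h : s.nf M₀ C a P) (hCD : K.Prec C D)
    (hD : K.InF lam th D) :
    ∃ Q g, K.InF lam th Q ∧ K.Prec D Q ∧ K.IsEmb g P Q ∧ (∀ x ∈ C.carrier, g x = x) ∧
      s.nf M₀ D (fun i => g (a i)) Q := by
  obtain ⟨-, hC, hP, h₀, hCP, ha, hn⟩ := hs.nf_domain h
  obtain ⟨_, _, hbs⟩ := hs.basic_of_nf (hs.nf_base h h₀ (K.refl hC.1) (K.refl hC.1))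
  obtain ⟨q, -, ⟨b, R, hDR, hb, rfl, hnf⟩, ⟨hCD, _, hqp⟩⟩ := hs.existence _ hbs hCD hD le_rfl hn
  obtain ⟨-, -, hR, -⟩ := hs.nf_domain hnf
  have hCR := K.trans hCD hDR
  obtain ⟨Q, g, hQ, hRQ, hg, hgC, hgb⟩ := (hs.hasAmalgamation.sameType_of_tp_eq hs.ls_le hC hR hP
    (h := hCR) (h' := hCP) (ha := hb) (hb := ha) hqp).exists_prec hCR hb
  refine ⟨Q, g, hQ, K.trans hDR hRQ, hg, hgC, ?_⟩
  rw [funext hgb]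
  exact hs.nf_trans (hs.nf_up hnf hRQ hQ) (hs.nf_emb h hg hQ hgC hgb)

theorem exists_nf_extension (h : s.nf M₀ C a P) (hf : K.IsEmb f C D) (hD : K.InF lam th D)
    (hfM : ∀ x ∈ M₀.carrier, f x = x) :
    ∃ Q g, K.InF lam th Q ∧ K.Prec D Q ∧ K.IsEmb g P Q ∧ (∀ x ∈ C.carrier, g x = f x) ∧
      s.nf M₀ D (fun i => g (a i)) Q := by
  obtain ⟨-, -, hP, h₀, hCP, -⟩ := hs.nf_domain h
  obtain ⟨C', hC', hC'D⟩ := hf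
  obtain ⟨k, P', hk, -, hkf⟩ := Prec.exists_extend hCP hC'
  have hkC : IsIso k C C' := hC'.congr fun x hx => (hkf x hx).symm
  have hkM : IsIso k M₀ M₀ :=
    IsIso.of_fixed fun x hx => (hkf x (h₀.subset hx)).trans (hfM x hx)
  obtain ⟨Q, g, hQ, hDQ, hg, hgC', hnf⟩ :=
    hs.exists_nf_extension_of_prec (hs.nf_iso h hkM hkC hk fun _ => rfl) hC'D hD
  exact ⟨Q, fun x => g (k x), hQ, hDQ, hg.comp (IsEmb.of_isIso hk (K.mem_iso hP.1 hk)),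
    fun x hx => (hgC' _ (hkC.mem hx)).trans (hkf x hx), hnf⟩

theorem exists_amalgam_of_nf (h : s.nf M₀ C a N) (h' : s.nf M₀ C' b N')
    (hab : K.SameType lam th M₀ a N b N') (hf : K.IsEmb f C D) (hf' : K.IsEmb f' C' D)
    (hD : K.InF lam th D) (hM : ∀ x ∈ M₀.carrier, f x = x ∧ f' x = x) :
    ∃ R g g', K.InF lam th R ∧ K.IsEmb g N R ∧ K.IsEmb g' N' R ∧ (∀ x ∈ C.carrier, g x = f x) ∧
      (∀ x ∈ C'.carrier, g' x = f' x) ∧ ∀ i, g (a i) = g' (b i) := by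
  obtain ⟨-, -, hN, h₀C, hCN, ha, -⟩ := hs.nf_domain h
  obtain ⟨-, -, hN', h₀C', hC'N', hb, -⟩ := hs.nf_domain h'
  obtain ⟨Q, g, hQ, hDQ, hg, hgC, hnf⟩ := hs.exists_nf_extension h hf hD fun x hx => (hM x hx).1
  obtain ⟨Q', g', hQ', -, hg', hgC', hnf'⟩ :=
    hs.exists_nf_extension h' hf' hD fun x hx => (hM x hx).2
  have hgM : ∀ x ∈ M₀.carrier, g x = x := fun x hx =>
    (hgC x (h₀C.subset hx)).trans (hM x hx).1
  have hgM' : ∀ x ∈ M₀.carrier, g' x = x := fun x hx =>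
    (hgC' x (h₀C'.subset hx)).trans (hM x hx).2
  have sameType_base : K.SameType lam th M₀ (fun i => g (a i)) Q (fun i => g' (b i)) Q' :=
    hs.hasAmalgamation.sameType_trans hN (K.trans h₀C hCN) ha
      (SameType.of_isEmb hg hQ hgM fun _ => rfl).symm
      (hs.hasAmalgamation.sameType_trans hN' (K.trans h₀C' hC'N') hb hab
        (SameType.of_isEmb hg' hQ' hgM' fun _ => rfl))
  obtain ⟨R, r, hR, hQR, hr, hrD, hrb⟩ :=
    (hs.sameType_of_nf hnf hnf' sameType_base).exists_prec hDQ fun i => hg.mem (ha i)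
  exact ⟨R, g, fun x => r (g' x), hR, hg.trans_prec hQR, hr.comp hg', hgC, fun x hx =>
    (congrArg r (hgC' x hx)).trans (hrD _ (hf'.mem hx)), fun i => (hrb i).symm⟩

theorem nf_exchange {x y : ZFSet.{u}} (h : s.nf M₀ C ![x] D) (h' : s.nf M₀ D ![y] N) :
    ∃ M₁ N', K.Prec N N' ∧ s.nf M₀ C ![y] M₁ ∧ s.nf M₀ M₁ ![x] N' := by
  obtain ⟨h₀, hC, hD, h₀C, hCD, hx, hn⟩ := hs.nf_domain h
  obtain ⟨-, -, hN, -, hDN, -⟩ := hs.nf_domain h'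
  have hbs := hs.basic_of_nf (hs.nf_base (hs.nf_up h hDN hN) h₀C (K.refl hC.1) (K.refl hC.1))
  obtain ⟨M₁, N', hyM₁, hNN', hnf⟩ :=
    hs.symmetry (hs.nf_base h' h₀C hCD (K.refl hD.1)) hn hx hbs
  obtain ⟨-, -, hN', hCM₁, hM₁N', -⟩ := hs.nf_domain hnf
  exact ⟨M₁, N', hNN',
    hs.nf_down (hs.nf_up (hs.nf_base h' (K.refl h₀.1) h₀C hCD) hNN' hN') hM₁N' hCM₁ hyM₁,
    hs.nf_trans hnf (hs.nf_up h (K.trans hDN hNN') hN')⟩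

end IsGoodExceptStability

end Nonforking

/-! ### Independent sequences -/

section IndependentSequences

open AEC

variable {L : FirstOrder.Language.{u, u}} {K : AEC L}
  {M M₀ M₀' M₁ M₁' M₂ N N' P B C D E : Model L} {f : ZFSet.{u} → ZFSet.{u}} {lam : Cardinal.{u}}
  {th : WithTop Cardinal.{u}} {s : FrameTriple K} {α : ℕ∞} {n : ℕ} {a : Fin n → ZFSet.{u}}
  {x y : ZFSet.{u}}

theorem comp_singleton (f : ZFSet.{u} → ZFSet.{u}) (x : ZFSet.{u}) :
    (fun i => f (![x] i)) = ![f x] :=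
  funext (Fin.forall_fin_one.2 rfl)

variable (lam th) in
/-- The sequence `a` is independent from `M₁` over `M₀`, as witnessed by a chain of models that
starts at `M₁` and ends at `N`. In contrast to `FrameTriple.Independent`, the chain is not taken in
an extension of `N`; it is encoded by recursion on the length, through its last but one model. -/
def FrameTriple.IndepBelow (s : FrameTriple K) :
    ∀ {n : ℕ} (_ : Fin n → ZFSet.{u}) (_ _ _ : Model L), Prop
  | 0, _, M₀, M₁, N =>
    K.InF lam th M₀ ∧ K.InF lam th M₁ ∧ K.InF lam th N ∧ K.Prec M₀ M₁ ∧ K.Prec M₁ N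
  | n + 1, a, M₀, M₁, N =>
    ∃ C, s.IndepBelow (fun i : Fin n => a i.castSucc) M₀ M₁ C ∧ s.nf M₀ C ![a (Fin.last n)] N

namespace IsPreFrame

variable (hs : IsPreFrame α lam th s)
include hs

theorem indepBelow_domain : ∀ {n : ℕ} {a : Fin n → ZFSet.{u}} {N : Model L},
    s.IndepBelow lam th a M₀ M₁ N → K.InF lam th M₀ ∧ K.InF lam th M₁ ∧ K.InF lam th N ∧
      K.Prec M₀ M₁ ∧ K.Prec M₁ N ∧ ∀ i, a i ∈ N.carrier
  | 0, _, _, ⟨h₀, h₁, hN, h₀₁, h₁N⟩ => ⟨h₀, h₁, hN, h₀₁, h₁N, fun i => i.elim0⟩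
  | _ + 1, _, _, ⟨_, hC, hnf⟩ => by
    obtain ⟨h₀, h₁, -, h₀₁, h₁C, ha⟩ := indepBelow_domain hC
    obtain ⟨-, -, hN, -, hCN, hlast, -⟩ := hs.nf_domain hnf
    exact ⟨h₀, h₁, hN, h₀₁, K.trans h₁C hCN, Fin.lastCases (hlast 0) fun i => hCN.subset (ha i)⟩

theorem indepBelow_up : ∀ {n : ℕ} {a : Fin n → ZFSet.{u}}, s.IndepBelow lam th a M₀ M₁ N →
    K.Prec N P → K.InF lam th P → s.IndepBelow lam th a M₀ M₁ P
  | 0, _, ⟨h₀, h₁, _, h₀₁, h₁N⟩, hNP, hP => ⟨h₀, h₁, hP, h₀₁, K.trans h₁N hNP⟩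
  | _ + 1, _, ⟨C, hC, hnf⟩, hNP, hP => ⟨C, hC, hs.nf_up hnf hNP hP⟩

theorem indepBelow_base (h₀ : K.Prec M₀ M₀') (h₁ : K.Prec M₀' M₁') (h₂ : K.Prec M₁' M₁) :
    ∀ {n : ℕ} {a : Fin n → ZFSet.{u}} {N : Model L}, s.IndepBelow lam th a M₀ M₁ N →
      s.IndepBelow lam th a M₀' M₁' N
  | 0, _, _, ⟨hM₀, hM₁, hN, _, h₁N⟩ =>
    ⟨hM₀.of_between hM₁ h₀ (K.trans h₁ h₂), hM₀.of_between hM₁ (K.trans h₀ h₁) h₂, hN, h₁,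
      K.trans h₂ h₁N⟩
  | _ + 1, _, _, ⟨C, hC, hnf⟩ => by
    obtain ⟨-, -, hCF, -, h₁C, -⟩ := hs.indepBelow_domain hC
    exact ⟨C, indepBelow_base h₀ h₁ h₂ hC,
      hs.nf_base hnf h₀ (K.trans h₁ (K.trans h₂ h₁C)) (K.refl hCF.1)⟩

theorem indepBelow_iso (h₀ : IsIso f M₀ M₀') (h₁ : IsIso f M₁ M₁') :
    ∀ {n : ℕ} {a b : Fin n → ZFSet.{u}} {N N' : Model L}, s.IndepBelow lam th a M₀ M₁ N →
      IsIso f N N' → (∀ i, f (a i) = b i) → s.IndepBelow lam th b M₀' M₁' N'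
  | 0, _, _, _, _, ⟨hM₀, hM₁, hN, h₀₁, h₁N⟩, hf, _ =>
    ⟨hM₀.of_isIso h₀, hM₁.of_isIso h₁, hN.of_isIso hf, K.prec_iso h₀₁ h₀ h₁, K.prec_iso h₁N h₁ hf⟩
  | n + 1, _, _, _, _, ⟨_, hC, hnf⟩, hf, hab => by
    obtain ⟨-, -, -, -, hCN, -⟩ := hs.nf_domain hnf
    obtain ⟨C', hC', -⟩ := hCN.exists_image hf
    exact ⟨C', indepBelow_iso h₀ h₁ hC hC' fun i => hab i.castSucc,
      hs.nf_iso hnf h₀ hC' hf (Fin.forall_fin_one.2 (hab (Fin.last n)))⟩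

theorem indepBelow_emb (h : s.IndepBelow lam th a M₀ M₁ N) (hf : K.IsEmb f N P)
    (hP : K.InF lam th P) (hM : ∀ x ∈ M₁.carrier, f x = x) :
    s.IndepBelow lam th (fun i => f (a i)) M₀ M₁ P := by
  obtain ⟨-, -, -, h₀₁, -⟩ := hs.indepBelow_domain h
  obtain ⟨R, hR, hRP⟩ := hf
  exact hs.indepBelow_up (hs.indepBelow_iso (IsIso.of_fixed fun x hx => hM x (h₀₁.subset hx))
    (IsIso.of_fixed hM) h hR fun _ => rfl) hRP hP

theorem indepBelow_subsequence : ∀ {n : ℕ} {a : Fin n → ZFSet.{u}} {N : Model L},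
    s.IndepBelow lam th a M₀ M₁ N → ∀ {m : ℕ} (e : Fin m → Fin n), StrictMono e →
      s.IndepBelow lam th (fun i => a (e i)) M₀ M₁ N
  | _, _, _, h, 0, _, _ => by
    obtain ⟨h₀, h₁, hN, h₀₁, h₁N, -⟩ := hs.indepBelow_domain h
    exact ⟨h₀, h₁, hN, h₀₁, h₁N⟩
  | 0, _, _, _, _ + 1, e, _ => (e 0).elim0
  | n + 1, a, N, ⟨C, hC, hnf⟩, m + 1, e, he => by
    obtain ⟨-, -, hN, -, hCN, -⟩ := hs.nf_domain hnf
    by_cases hlast : e (Fin.last m) = Fin.last n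
    · have hne : ∀ i : Fin m, e i.castSucc ≠ Fin.last n := fun i =>
        (hlast ▸ he (Fin.castSucc_lt_last i)).ne
      have init := indepBelow_subsequence hC (fun i : Fin m => (e i.castSucc).castPred (hne i))
        fun i j hij => Fin.castPred_lt_castPred_iff.2 (he (Fin.castSucc_lt_castSucc_iff.2 hij))
      simp only [Fin.castSucc_castPred] at init
      exact ⟨C, init, by rwa [← hlast] at hnf⟩
    · have hne : ∀ i : Fin (m + 1), e i ≠ Fin.last n := fun i h =>
        hlast (le_antisymm (Fin.le_last _) (h ▸ he.monotone (Fin.le_last i)))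
      have init := indepBelow_subsequence hC (fun i : Fin (m + 1) => (e i).castPred (hne i))
        fun i j hij => Fin.castPred_lt_castPred_iff.2 (he hij)
      simp only [Fin.castSucc_castPred] at init
      exact hs.indepBelow_up init hCN hN

theorem nf_of_indepBelow : ∀ {n : ℕ} {a : Fin n → ZFSet.{u}} {N : Model L},
    s.IndepBelow lam th a M₀ M₁ N → ∀ i, s.nf M₀ M₁ ![a i] N
  | 0, _, _, _, i => i.elim0
  | _ + 1, _, _, ⟨_, hC, hnf⟩, i => by
    obtain ⟨-, -, hN, -, hCN, -⟩ := hs.nf_domain hnf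
    obtain ⟨h₀, -, -, h₀₁, h₁C, -⟩ := hs.indepBelow_domain hC
    exact Fin.lastCases (motive := fun i => s.nf _ _ ![_] _) (hs.nf_base hnf (K.refl h₀.1) h₀₁ h₁C)
      (fun i => hs.nf_up (nf_of_indepBelow hC i) hCN hN) i

theorem indepBelow_singleton : s.IndepBelow lam th ![x] M₀ M₁ N ↔ s.nf M₀ M₁ ![x] N := by
  refine ⟨fun h => hs.nf_of_indepBelow h 0, fun h => ?_⟩
  obtain ⟨h₀, h₁, -, h₀₁, -⟩ := hs.nf_domain h
  exact ⟨M₁, ⟨h₀, h₁, h₁, h₀₁, K.refl h₁.1⟩, h⟩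

end IsPreFrame

namespace IsGoodExceptStability

variable (hs : IsGoodExceptStability α lam th s)
include hs

theorem indepBelow_trans : ∀ {n : ℕ} {a : Fin n → ZFSet.{u}} {N : Model L},
    s.IndepBelow lam th a M₁ M₂ N → K.InF lam th M₀ → K.Prec M₀ M₁ →
      (∀ i, s.nf M₀ M₁ ![a i] N) → s.IndepBelow lam th a M₀ M₂ N
  | 0, _, _, ⟨_, h₂, hN, h₁₂, h₂N⟩, h₀, h₀₁, _ => ⟨h₀, h₂, hN, K.trans h₀₁ h₁₂, h₂N⟩
  | n + 1, _, _, ⟨C, hC, hnf⟩, h₀, h₀₁, ha => by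
    obtain ⟨-, -, -, -, hCN, -⟩ := hs.nf_domain hnf
    obtain ⟨-, -, -, h₁₂, h₂C, haC⟩ := hs.indepBelow_domain hC
    exact ⟨C, indepBelow_trans hC h₀ h₀₁ fun i =>
      hs.nf_down (ha i.castSucc) hCN (K.trans h₁₂ h₂C) (Fin.forall_fin_one.2 (haC i)),
      hs.nf_trans hnf (ha (Fin.last n))⟩

theorem exists_indepBelow_extension (hCE : K.Prec C E) (hE : K.InF lam th E) :
    ∀ {n : ℕ} {a : Fin n → ZFSet.{u}} {P : Model L}, s.IndepBelow lam th a M₀ C P →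
      ∃ Q g, K.InF lam th Q ∧ K.Prec E Q ∧ K.IsEmb g P Q ∧ (∀ x ∈ C.carrier, g x = x) ∧
        s.IndepBelow lam th (fun i => g (a i)) M₀ E Q
  | 0, _, _, ⟨h₀, hC, hP, h₀C, hCP⟩ => by
    obtain ⟨Q, g, hQ, hEQ, hg, hgC⟩ := hs.hasAmalgamation.exists_prec hC hE hP hCE hCP
    exact ⟨Q, g, hQ, hEQ, hg, hgC, h₀, hE, hQ, K.trans h₀C hCE, hEQ⟩
  | n + 1, a, _, ⟨C', hC', hnf⟩ => by
    obtain ⟨-, -, -, h₀C, hCC', ha⟩ := hs.indepBelow_domain hC'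
    obtain ⟨D, g, hD, hED, hg, hgC, hind⟩ := exists_indepBelow_extension hCE hE hC'
    obtain ⟨Q, k, hQ, hDQ, hk, hkg, hnfQ⟩ :=
      hs.exists_nf_extension hnf hg hD fun x hx => hgC x (h₀C.subset hx)
    have hka : (fun i : Fin n => k (a i.castSucc)) = fun i => g (a i.castSucc) :=
      funext fun i => hkg _ (ha i)
    exact ⟨Q, k, hQ, K.trans hED hDQ, hk,
      fun x hx => (hkg x (hCC'.subset hx)).trans (hgC x hx), D, by rwa [hka],
      by rwa [comp_singleton] at hnfQ⟩

theorem exists_isIso_indepBelow (h : s.IndepBelow lam th a M₀ C P) (hCE : K.Prec C E)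
    (hE : K.InF lam th E) :
    ∃ Q D k, K.Prec P Q ∧ IsIso k E D ∧ (∀ x ∈ C.carrier, k x = x) ∧
      s.IndepBelow lam th a M₀ D Q := by
  obtain ⟨-, -, -, h₀, hCP, -⟩ := hs.indepBelow_domain h
  obtain ⟨Q', g, -, hEQ', hg, hgC, hind⟩ := hs.exists_indepBelow_extension hCE hE h
  obtain ⟨k, Q, hk, hPQ, hkg⟩ := hg.exists_prec
  obtain ⟨D, hkD, -⟩ := hEQ'.exists_image hk
  have hkC : ∀ x ∈ C.carrier, k x = x := fun x hx =>
    (congrArg k (hgC x hx)).symm.trans (hkg x (hCP.subset hx))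
  obtain ⟨-, -, -, -, -, ha⟩ := hs.indepBelow_domain h
  exact ⟨Q, D, k, hPQ, hkD, hkC,
    hs.indepBelow_iso (IsIso.of_fixed fun x hx => hkC x (h₀.subset hx)) hkD hind hk
      fun i => hkg _ (ha i)⟩

theorem exists_indepBelow_snoc (h : s.IndepBelow lam th a M₀ M₁ N) :
    ∃ x Q, K.Prec N Q ∧ s.IndepBelow lam th (Fin.snoc a x : Fin (n + 1) → ZFSet.{u}) M₀ M₁ Q := by
  obtain ⟨h₀, -, hN, h₀₁, h₁N, -⟩ := hs.indepBelow_domain h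
  obtain ⟨x, P, hx⟩ := hs.exists_nf h₀
  obtain ⟨Q, g, -, hNQ, -, -, hnf⟩ := hs.exists_nf_extension_of_prec hx (K.trans h₀₁ h₁N) hN
  refine ⟨g x, Q, hNQ, N, by simpa only [Fin.snoc_castSucc], ?_⟩
  rwa [Fin.snoc_last, ← comp_singleton]

theorem exists_indepBelow_append (h : s.IndepBelow lam th a M₀ M₁ N) {k : ℕ} (hk : n ≤ k) :
    ∃ (c : Fin k → ZFSet.{u}) (Q : Model L), K.Prec N Q ∧ (∀ i, c (Fin.castLE hk i) = a i) ∧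
      s.IndepBelow lam th c M₀ M₁ Q := by
  induction k, hk using Nat.le_induction with
  | base => exact ⟨a, N, K.refl (hs.indepBelow_domain h).2.2.1.1, fun _ => rfl, h⟩
  | succ k hk ih =>
    obtain ⟨c, Q, hNQ, hc, hind⟩ := ih
    obtain ⟨x, R, hQR, hind'⟩ := hs.exists_indepBelow_snoc hind
    exact ⟨Fin.snoc c x, R, K.trans hNQ hQR,
      fun i => (Fin.snoc_castSucc (α := fun _ => ZFSet) x c (Fin.castLE hk i)).trans (hc i), hind'⟩

theorem sameType_of_indepBelow : ∀ {n : ℕ} {a b : Fin n → ZFSet.{u}} {N N' : Model L},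
    s.IndepBelow lam th a M₀ M₁ N → s.IndepBelow lam th b M₀ M₁ N' →
      (∀ i, K.SameType lam th M₀ ![a i] N ![b i] N') → K.SameType lam th M₁ a N b N'
  | 0, _, _, _, _, ⟨_, h₁, hN, _, h₁N⟩, ⟨_, _, hN', _, h₁N'⟩, _ =>
    hs.hasAmalgamation.sameType_zero h₁ hN hN' h₁N h₁N' _ _
  | n + 1, _, _, _, _, ⟨_, hC, hnf⟩, ⟨_, hC', hnf'⟩, hab => by
    obtain ⟨-, -, -, h₀₁, h₁C, ha⟩ := hs.indepBelow_domain hC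
    obtain ⟨-, -, -, -, h₁C', hb⟩ := hs.indepBelow_domain hC'
    obtain ⟨-, -, -, -, hCN, -⟩ := hs.nf_domain hnf
    obtain ⟨-, -, -, -, hCN', -⟩ := hs.nf_domain hnf'
    obtain ⟨D, f, f', hD, hf, hf', hfM, hfab⟩ :=
      sameType_of_indepBelow hC hC' fun i => (hab i.castSucc).mono hCN hCN'
    obtain ⟨R, g, g', hR, hg, hg', hgC, hgC', hlast⟩ :=
      hs.exists_amalgam_of_nf hnf hnf' (hab (Fin.last n)) hf hf' hD
        fun x hx => hfM x (h₀₁.subset hx)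
    exact ⟨R, g, g', hR, hg, hg',
      fun x hx => ⟨(hgC x (h₁C.subset hx)).trans (hfM x hx).1,
        (hgC' x (h₁C'.subset hx)).trans (hfM x hx).2⟩,
      Fin.lastCases (hlast 0) fun i =>
        (hgC _ (ha i)).trans ((hfab i).trans (hgC' _ (hb i)).symm)⟩

theorem exists_nf_over_indepBelow {m : ℕ} {b : Fin m → ZFSet.{u}} (h : s.nf M₀ C ![x] P)
    (hb : s.IndepBelow lam th b M₀ B M) (ha : s.IndepBelow lam th a M₀ M N) (hBC : K.Prec B C)
    (hCN : K.Prec C N) (hbC : ∀ i, b i ∈ C.carrier) (haC : ∀ i, a i ∈ C.carrier) :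
    ∃ M' N' Q, K.Prec P Q ∧ s.IndepBelow lam th b M₀ B M' ∧ s.IndepBelow lam th a M₀ M' N' ∧
      s.nf M₀ N' ![x] Q := by
  obtain ⟨-, -, -, h₀B, -⟩ := hs.indepBelow_domain hb
  obtain ⟨-, -, hN, -, hMN, -⟩ := hs.indepBelow_domain ha
  obtain ⟨Q, N', k, hPQ, hkN, hkC, hind⟩ :=
    hs.exists_isIso_indepBelow (hs.indepBelow_singleton.2 h) hCN hN
  obtain ⟨M', hkM, -⟩ := hMN.exists_image hkN
  have hkB : ∀ x ∈ B.carrier, k x = x := fun x hx => hkC x (hBC.subset hx)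
  have hkM₀ : IsIso k M₀ M₀ := IsIso.of_fixed fun x hx => hkB x (h₀B.subset hx)
  exact ⟨M', N', Q, hPQ,
    hs.indepBelow_iso hkM₀ (IsIso.of_fixed hkB) hb hkM fun i => hkC _ (hbC i),
    hs.indepBelow_iso hkM₀ hkM ha hkN fun i => hkC _ (haC i), hs.indepBelow_singleton.1 hind⟩

theorem indepBelow_exchange_nf : ∀ {n : ℕ} {a : Fin n → ZFSet.{u}} {C N : Model L},
    s.IndepBelow lam th a M₀ B C → s.nf M₀ C ![y] N →
      ∃ M₁ N', K.Prec N N' ∧ s.nf M₀ B ![y] M₁ ∧ s.IndepBelow lam th a M₀ M₁ N'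
  | 0, _, _, N, ⟨h₀, _, _, h₀B, hBC⟩, hnf => by
    obtain ⟨-, -, hN, h₀C, hCN, -⟩ := hs.nf_domain hnf
    have hNN := K.refl hN.1
    exact ⟨N, N, hNN, hs.nf_base hnf (K.refl h₀.1) h₀B hBC, h₀, hN, hN, K.trans h₀C hCN, hNN⟩
  | n + 1, _, _, _, ⟨C, hC, hnf⟩, hnf' => by
    obtain ⟨-, -, -, -, hBC, haC⟩ := hs.indepBelow_domain hC
    obtain ⟨M₁, N₁, hNN₁, hy, hx⟩ := hs.nf_exchange hnf hnf'
    obtain ⟨-, -, -, -, hCM₁, hyM₁, -⟩ := hs.nf_domain hy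
    obtain ⟨M₂, N₂, hM₁N₂, hy₂, ha₂⟩ := indepBelow_exchange_nf hC hy
    obtain ⟨M₃, N₃, Q, hN₁Q, hy₃, ha₃, hx₃⟩ :=
      hs.exists_nf_over_indepBelow hx (hs.indepBelow_singleton.2 hy₂) ha₂ (K.trans hBC hCM₁)
        hM₁N₂ hyM₁ fun i => hCM₁.subset (haC i)
    exact ⟨M₃, Q, K.trans hNN₁ hN₁Q, hs.indepBelow_singleton.1 hy₃, N₃, ha₃, hx₃⟩

theorem indepBelow_exchange (ha : s.IndepBelow lam th a M₀ B C) :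
    ∀ {m : ℕ} {b : Fin m → ZFSet.{u}} {N : Model L}, s.IndepBelow lam th b M₀ C N →
      ∃ M₁ N', K.Prec N N' ∧ s.IndepBelow lam th b M₀ B M₁ ∧ s.IndepBelow lam th a M₀ M₁ N'
  | 0, _, N, ⟨h₀, _, hN, _, hCN⟩ => by
    obtain ⟨-, hB, -, h₀B, -⟩ := hs.indepBelow_domain ha
    exact ⟨B, N, K.refl hN.1, ⟨h₀, hB, hB, h₀B, K.refl hB.1⟩, hs.indepBelow_up ha hCN hN⟩
  | m + 1, _, N, ⟨D, hD, hnf⟩ => by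
    obtain ⟨-, -, -, -, hBC, haC⟩ := hs.indepBelow_domain ha
    obtain ⟨-, -, -, -, hCD, hbD⟩ := hs.indepBelow_domain hD
    obtain ⟨M₁, N₁, hDN₁, hb₁, ha₁⟩ := indepBelow_exchange ha hD
    obtain ⟨M₂, N₂, Q, hNQ, hb₂, ha₂, hlast⟩ := hs.exists_nf_over_indepBelow hnf hb₁ ha₁
      (K.trans hBC hCD) hDN₁ hbD fun i => hCD.subset (haC i)
    obtain ⟨M₃, N₃, hQN₃, hlast', ha₃⟩ := hs.indepBelow_exchange_nf ha₂ hlast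
    exact ⟨M₃, N₃, K.trans hNQ hQN₃, ⟨M₂, hb₂, hlast'⟩, ha₃⟩

end IsGoodExceptStability

end IndependentSequences

/-! ### The elongation -/

section Elongation

open AEC

variable {L : FirstOrder.Language.{u, u}} {K : AEC L} {M M₀ M₀' M₁ M₁' M₂ N N' N'' : Model L}
  {f : ZFSet.{u} → ZFSet.{u}} {lam : Cardinal.{u}} {th : WithTop Cardinal.{u}}
  {s : FrameTriple K} {α β : ℕ∞} {m n : ℕ} {a : Fin n → ZFSet.{u}}

theorem FrameTriple.elongation_mem_bs_iff {p : GType K M n} :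
    p ∈ (s.elongation β lam th).bs M n ↔ (s.elongation β lam th).DoesNotFork p M := by
  constructor
  · rintro ⟨hn, hM, a, N, h, ha, rfl, hN, hind⟩
    exact ⟨a, N, h, ha, rfl, hn, hM, hM, hN, hind⟩
  · rintro ⟨a, N, h, ha, rfl, hn, hM, -, hN, hind⟩
    exact ⟨hn, hM, a, N, h, ha, rfl, hN, hind⟩

theorem FrameTriple.indepBelow_of_chain :
    ∀ {n : ℕ} {a : Fin n → ZFSet.{u}} {C : Fin (n + 1) → Model L},
      K.InF lam th M₀ → K.InF lam th (C 0) → K.Prec M₀ (C 0) →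
      (∀ i : Fin n, s.nf M₀ (C i.castSucc) ![a i] (C i.succ)) →
        s.IndepBelow lam th a M₀ (C 0) (C (Fin.last n))
  | 0, _, _, h₀, hC₀, h, _ => ⟨h₀, hC₀, hC₀, h, K.refl hC₀.1⟩
  | n + 1, _, C, h₀, hC₀, h, hC =>
    ⟨C (Fin.last n).castSucc,
      indepBelow_of_chain (C := fun i : Fin (n + 1) => C i.castSucc) h₀ hC₀ h
        (fun i => hC i.castSucc), hC (Fin.last n)⟩

namespace IsPreFrame

section Chains

variable (hs : IsPreFrame α lam th s) {C : Fin (n + 1) → Model L}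
include hs

theorem inF_of_chain (h₀ : K.InF lam th (C 0))
    (hC : ∀ i : Fin n, s.nf M₀ (C i.castSucc) ![a i] (C i.succ)) (i : Fin (n + 1)) :
    K.InF lam th (C i) :=
  Fin.cases h₀ (fun i => (hs.nf_domain (hC i)).2.2.1) i

theorem prec_of_chain (h₀ : K.InF lam th (C 0))
    (hC : ∀ i : Fin n, s.nf M₀ (C i.castSucc) ![a i] (C i.succ)) (i j : Fin (n + 1))
    (hij : i ≤ j) : K.Prec (C i) (C j) := by
  have : IsTrans (Model L) K.Prec := ⟨fun _ _ _ => K.trans⟩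
  rcases hij.eq_or_lt with rfl | hij
  · exact K.refl (hs.inF_of_chain h₀ hC i).1
  · exact (Fin.liftFun_iff_succ K.Prec).2 (fun i => (hs.nf_domain (hC i)).2.2.2.2.1) hij

theorem exists_chain : ∀ {n : ℕ} {a : Fin n → ZFSet.{u}} {N : Model L},
    s.IndepBelow lam th a M₀ M₁ N → ∃ C : Fin (n + 1) → Model L, C 0 = M₁ ∧
      K.Prec (C (Fin.last n)) N ∧ ∀ i : Fin n, s.nf M₀ (C i.castSucc) ![a i] (C i.succ)
  | 0, _, _, ⟨_, _, _, _, h₁N⟩ => ⟨fun _ => M₁, rfl, h₁N, fun i => i.elim0⟩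
  | n + 1, a, N, ⟨D, hD, hnf⟩ => by
    obtain ⟨h₀, h₁, -, h₀₁, -⟩ := hs.indepBelow_domain hD
    obtain ⟨-, -, hN, -⟩ := hs.nf_domain hnf
    obtain ⟨C, rfl, hCD, hC⟩ := exists_chain hD
    refine ⟨Fin.snoc (α := fun _ => Model L) C N, Fin.snoc_castSucc _ _ 0, ?_,
      Fin.lastCases ?_ fun i => ?_⟩
    · rw [Fin.snoc_last]
      exact K.refl hN.1
    · rw [Fin.snoc_castSucc, Fin.succ_last, Fin.snoc_last]
      exact hs.nf_base hnf (K.refl h₀.1)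
        (K.trans h₀₁ (hs.prec_of_chain h₁ hC 0 _ (Fin.zero_le _))) hCD
    · rw [Fin.snoc_castSucc, Fin.succ_castSucc, Fin.snoc_castSucc]
      exact hC i

end Chains

variable (hs : IsPreFrame α lam th s)
include hs

theorem elongation_nf_iff :
    (s.elongation β lam th).nf M₀ M₁ a N ↔ (n : ℕ∞) < β ∧ K.InF lam th N ∧ K.Prec M₁ N ∧
      (∀ i, a i ∈ N.carrier) ∧ ∃ N₁, K.Prec N N₁ ∧ s.IndepBelow lam th a M₀ M₁ N₁ := by
  constructor
  · rintro ⟨hn, h₀, h₁, hN, h₀₁, h₁N, ha, C, N₁, rfl, hCN, hNN, -, -, -, -, -, -, -, -, hC⟩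
    obtain ⟨N₂, hN₂, -, hCN₂, hNN₂⟩ :=
      (hs.inF_of_chain h₁ hC (Fin.last n)).exists_prec_of_prec hs.ls_le hN hCN hNN
    exact ⟨hn, hN, h₁N, ha, N₂, hNN₂,
      hs.indepBelow_up (FrameTriple.indepBelow_of_chain h₀ h₁ h₀₁ hC) hCN₂ hN₂⟩
  · rintro ⟨hn, hN, h₁N, ha, N₁, hNN, hind⟩
    obtain ⟨h₀, h₁, -, h₀₁, -⟩ := hs.indepBelow_domain hind
    obtain ⟨C, rfl, hCN, hC⟩ := hs.exists_chain hind
    have hCF := hs.inF_of_chain h₁ hC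
    exact ⟨hn, h₀, h₁, hN, h₀₁, h₁N, ha, C, N₁, rfl, hCN, hNN, hs.prec_of_chain h₁ hC, hCF, h₀₁,
      K.refl h₁.1, h₀, h₁, K.refl (hCF _).1, hCF _, hC⟩

theorem elongation_nf_of_indepBelow (hn : (n : ℕ∞) < β) (h : s.IndepBelow lam th a M₀ M₁ N) :
    (s.elongation β lam th).nf M₀ M₁ a N := by
  obtain ⟨-, -, hN, -, h₁N, ha⟩ := hs.indepBelow_domain h
  exact hs.elongation_nf_iff.2 ⟨hn, hN, h₁N, ha, N, K.refl hN.1, h⟩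

theorem elongation_doesNotFork_iff {p : GType K M₁ n} :
    (s.elongation β lam th).DoesNotFork p M₀ ↔ (n : ℕ∞) < β ∧ ∃ (a : Fin n → ZFSet.{u})
      (N : Model L) (h : K.Prec M₁ N) (ha : ∀ i, a i ∈ N.carrier),
        p = tp h ha ∧ s.IndepBelow lam th a M₀ M₁ N := by
  constructor
  · rintro ⟨a, N, h, ha, rfl, hnf⟩
    obtain ⟨hn, -, -, -, N₁, hNN, hind⟩ := hs.elongation_nf_iff.1 hnf
    exact ⟨hn, a, N₁, K.trans h hNN, fun i => hNN.subset (ha i), tp_eq_of_prec hNN _ _ _ _, hind⟩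
  · rintro ⟨hn, a, N, h, ha, rfl, hind⟩
    exact ⟨a, N, h, ha, rfl, hs.elongation_nf_of_indepBelow hn hind⟩

theorem elongation_nf_of_doesNotFork (hAP : K.HasAmalgamation lam th) (hN : K.InF lam th N)
    {h : K.Prec M₁ N} {ha : ∀ i, a i ∈ N.carrier}
    (hp : (s.elongation β lam th).DoesNotFork (tp h ha) M₀) :
    (s.elongation β lam th).nf M₀ M₁ a N := by
  obtain ⟨hn, b, N', h', hb, heq, hind⟩ := hs.elongation_doesNotFork_iff.1 hp
  obtain ⟨-, h₁, hN', -⟩ := hs.indepBelow_domain hind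
  obtain ⟨R, g, hR, hNR, hg, hgM, hgb⟩ :=
    (hAP.sameType_of_tp_eq hs.ls_le h₁ hN hN' heq).exists_prec h ha
  have hindR := hs.indepBelow_emb hind hg hR hgM
  rw [funext hgb] at hindR
  exact hs.elongation_nf_iff.2 ⟨hn, hN, h, ha, R, hNR, hindR⟩

theorem elongation_basic_iff (hAP : K.HasAmalgamation lam th) :
    (s.elongation β lam th).Basic M a N ↔
      ∃ N₀, K.Prec N₀ N ∧ (s.elongation β lam th).nf M M a N₀ := by
  constructor
  · rintro ⟨h, ha, hp⟩
    obtain ⟨N₀, hN₀, hN₀N, hMN₀, ha₀⟩ := hp.2.1.exists_prec_of_tuple hs.ls_le h ha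
    rw [← tp_eq_of_prec hN₀N hMN₀ h ha₀ ha] at hp
    exact ⟨N₀, hN₀N,
      hs.elongation_nf_of_doesNotFork hAP hN₀ (FrameTriple.elongation_mem_bs_iff.1 hp)⟩
  · rintro ⟨N₀, hN₀N, hnf⟩
    obtain ⟨-, -, hMN₀, ha, -⟩ := hs.elongation_nf_iff.1 hnf
    exact ⟨K.trans hMN₀ hN₀N, fun i => hN₀N.subset (ha i), FrameTriple.elongation_mem_bs_iff.2
      ⟨a, N₀, hMN₀, ha, (tp_eq_of_prec hN₀N _ _ _ _).symm, hnf⟩⟩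

theorem elongation_nf_invariance (hN : IsIso f N N') (h₀ : IsIso f M₀ M₀') (h₁ : IsIso f M₁ M₁')
    (h : (s.elongation β lam th).nf M₀ M₁ a N) :
    (s.elongation β lam th).nf M₀' M₁' (fun i => f (a i)) N' := by
  obtain ⟨hn, hNF, h₁N, ha, N₁, hNN₁, hind⟩ := hs.elongation_nf_iff.1 h
  obtain ⟨-, -, -, h₀₁, -⟩ := hs.indepBelow_domain hind
  obtain ⟨g, N₁', hg, hNN₁', hgf⟩ := hNN₁.exists_extend hN
  have hgM : ∀ x ∈ M₁.carrier, f x = g x := fun x hx => (hgf x (h₁N.subset hx)).symm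
  exact hs.elongation_nf_iff.2 ⟨hn, hNF.of_isIso hN, K.prec_iso h₁N h₁ hN, fun i => hN.mem (ha i),
    N₁', hNN₁', hs.indepBelow_iso (h₀.congr fun x hx => hgM x (h₀₁.subset hx)) (h₁.congr hgM) hind
      hg fun i => hgf _ (ha i)⟩

theorem elongation_nf_monotonicity (hAP : K.HasAmalgamation lam th) (e : Fin m ↪o Fin n)
    (h : (s.elongation β lam th).nf M₀ M₁ a N) (h₀ : K.Prec M₀ M₀') (h₁ : K.Prec M₀' M₁')
    (h₂ : K.Prec M₁' M₁) (h₃ : K.Prec M₁ N') (h₄ : K.Prec N' N) (h₅ : K.Prec N N'')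
    (hN'' : K.InF lam th N'') (ha : ∀ i, a (e i) ∈ N'.carrier) :
    (s.elongation β lam th).nf M₀' M₁' (fun i => a (e i)) N' ∧
      (s.elongation β lam th).nf M₀' M₁' (fun i => a (e i)) N'' := by
  obtain ⟨hn, hN, h₁N, haN, N₁, hNN₁, hind⟩ := hs.elongation_nf_iff.1 h
  obtain ⟨-, hM₁, hN₁, -⟩ := hs.indepBelow_domain hind
  have hm : (m : ℕ∞) < β :=
    lt_of_le_of_lt (by simpa using Fintype.card_le_of_embedding e.toEmbedding) hn
  have hsub := hs.indepBelow_subsequence (hs.indepBelow_base h₀ h₁ h₂ hind) e e.strictMono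
  obtain ⟨Q, g, hQ, hNQ, hg, hgN⟩ := hAP.exists_prec hN hN'' hN₁ h₅ hNN₁
  have hsubQ := hs.indepBelow_emb hsub hg hQ fun x hx => hgN x (h₁N.subset (h₂.subset hx))
  rw [funext fun i => hgN (a (e i)) (haN _)] at hsubQ
  exact ⟨hs.elongation_nf_iff.2 ⟨hm, hM₁.of_between hN h₃ h₄, K.trans h₂ h₃, ha, N₁,
    K.trans h₄ hNN₁, hsub⟩, hs.elongation_nf_iff.2 ⟨hm, hN'', K.trans h₂ (K.trans h₁N h₅),
      fun i => h₅.subset (haN _), Q, hNQ, hsubQ⟩⟩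

theorem coord_mem_bs {p : GType K M n} (hp : p ∈ (s.elongation β lam th).bs M n) (k : ℕ)
    (hk : k < n) : p.coord k hk ∈ s.bs M 1 := by
  obtain ⟨-, a, N, h, ha, rfl, hind⟩ :=
    hs.elongation_doesNotFork_iff.1 (FrameTriple.elongation_mem_bs_iff.1 hp)
  obtain ⟨_, _, hbs⟩ := hs.basic_of_nf (hs.nf_of_indepBelow hind ⟨k, hk⟩)
  exact hbs

theorem elongation_nonalgebraic {p : GType K M n} (hp : p ∈ (s.elongation β lam th).bs M n) :
    p.Nonalgebraic := by
  obtain ⟨-, a, N, h, ha, rfl, -⟩ :=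
    hs.elongation_doesNotFork_iff.1 (FrameTriple.elongation_mem_bs_iff.1 hp)
  exact ⟨⟨N, h, a, ha⟩, rfl, fun i =>
    (hs.bs_subset _ (hs.coord_mem_bs hp i i.2)).2.2.notMem 0⟩

theorem elongation (hAP : K.HasAmalgamation lam th) :
    IsPreFrame β lam th (s.elongation β lam th) where
  lt := hs.lt
  ls_le := hs.ls_le
  exists_size_eq := hs.exists_size_eq
  bs_subset p hp := ⟨hp.2.1, hp.1, hs.elongation_nonalgebraic hp⟩
  nf_domain h := by
    obtain ⟨hn, h₀, h₁, hN, h₀₁, h₁N, ha, -⟩ := h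
    exact ⟨h₀, h₁, hN, h₀₁, h₁N, ha, hn⟩
  nf_invariance := hs.elongation_nf_invariance
  bs_invariance hN hM h := by
    obtain ⟨N₀, hN₀N, hnf⟩ := (hs.elongation_basic_iff hAP).1 h
    obtain ⟨N₀', hN₀', hN₀N'⟩ := hN₀N.exists_image hN
    exact (hs.elongation_basic_iff hAP).2
      ⟨N₀', hN₀N', hs.elongation_nf_invariance hN₀' hM hM hnf⟩
  nf_monotonicity := hs.elongation_nf_monotonicity hAP
  bs_monotonicity e h := by
    obtain ⟨N₀, hN₀N, hnf⟩ := (hs.elongation_basic_iff hAP).1 h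
    obtain ⟨-, hN₀, hMN₀, ha, -⟩ := hs.elongation_nf_iff.1 hnf
    have hNN := K.refl hN₀.1
    have hMM := K.refl (K.mem_of_prec hMN₀).1
    exact (hs.elongation_basic_iff hAP).2 ⟨N₀, hN₀N,
      (hs.elongation_nf_monotonicity hAP e hnf hMM hMM hMM hMN₀ hNN hNN hN₀ fun i => ha _).1⟩
  basic_of_nf h := (hs.elongation_basic_iff hAP).2 ⟨_, K.refl h.2.2.2.1.1, h⟩

end IsPreFrame

namespace IsGoodExceptStability

variable (hs : IsGoodExceptStability α lam th s)
include hs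

theorem elongation_bs_one (hβ : 1 < β) : (s.elongation β lam th).bs M 1 = s.bs M 1 := by
  ext p
  rw [FrameTriple.elongation_mem_bs_iff, hs.elongation_doesNotFork_iff]
  have eq_singleton (a : Fin 1 → ZFSet.{u}) : a = ![a 0] := funext (Fin.forall_fin_one.2 rfl)
  constructor
  · rintro ⟨-, a, N, h, ha, rfl, hind⟩
    rw [eq_singleton a, hs.indepBelow_singleton, ← eq_singleton] at hind
    obtain ⟨_, _, hbs⟩ := hs.basic_of_nf hind
    exact hbs
  · intro hp
    obtain ⟨a, N, h, ha, rfl, hnf⟩ := hs.doesNotFork_of_mem_bs hp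
    refine ⟨mod_cast hβ, a, N, h, ha, rfl, ?_⟩
    rwa [eq_singleton a, hs.indepBelow_singleton, ← eq_singleton]

theorem elongation_existence {p : GType K M m} (hp : p ∈ (s.elongation β lam th).bs M m)
    (hMN : K.Prec M N) (hN : K.InF lam th N) (hmn : m ≤ n) (hn : (n : ℕ∞) < β) :
    ∃ q ∈ (s.elongation β lam th).bs N n,
      (s.elongation β lam th).DoesNotFork q M ∧ q.Extends p := by
  obtain ⟨-, a, P, h, ha, rfl, hind⟩ :=
    hs.elongation_doesNotFork_iff.1 (FrameTriple.elongation_mem_bs_iff.1 hp)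
  obtain ⟨c, P', hPP', hca, hind'⟩ := hs.exists_indepBelow_append hind hmn
  obtain ⟨Q, g, -, hNQ, hg, hgM, hindQ⟩ := hs.exists_indepBelow_extension hMN hN hind'
  obtain ⟨-, -, -, -, -, hc⟩ := hs.indepBelow_domain hindQ
  have hdnf : (s.elongation β lam th).DoesNotFork (tp hNQ hc) M :=
    hs.elongation_doesNotFork_iff.2 ⟨hn, _, Q, hNQ, hc, rfl, hindQ⟩
  refine ⟨tp hNQ hc, FrameTriple.elongation_mem_bs_iff.2
    ((hs.toIsPreFrame.elongation hs.hasAmalgamation).doesNotFork_base hdnf hMN (K.refl hN.1)),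
    hdnf, hMN, hmn, ?_⟩
  exact (tp_eq_of_isEmb (hg.restrict hPP') hgM (fun i => congrArg g (hca i).symm) _ _ _ _).symm

theorem elongation_uniqueness (p q : GType K N n) (h : K.Prec M N)
    (hp : (s.elongation β lam th).DoesNotFork p M) (hq : (s.elongation β lam th).DoesNotFork q M)
    (hpq : p.restrict h le_rfl = q.restrict h le_rfl) : p = q := by
  obtain ⟨-, a, N₁, h₁, ha, rfl, hind⟩ := hs.elongation_doesNotFork_iff.1 hp
  obtain ⟨-, b, N₂, h₂, hb, rfl, hind'⟩ := hs.elongation_doesNotFork_iff.1 hq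
  obtain ⟨hM, -, hN₁, -⟩ := hs.indepBelow_domain hind
  obtain ⟨-, -, hN₂, -⟩ := hs.indepBelow_domain hind'
  have hab : K.SameType lam th M a N₁ b N₂ :=
    hs.hasAmalgamation.sameType_of_tp_eq hs.ls_le hM hN₁ hN₂ (h := K.trans h h₁)
      (h' := K.trans h h₂) (ha := ha) (hb := hb) hpq
  refine (hs.sameType_of_indepBelow hind hind' fun i => ?_).tp_eq _ _ _ _
  convert hab.comp (fun _ : Fin 1 => i) using 1 <;> exact funext (Fin.forall_fin_one.2 rfl)

theorem elongation_symmetry {a₁ : Fin m → ZFSet.{u}} {a₂ : Fin n → ZFSet.{u}}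
    (h : (s.elongation β lam th).nf M₀ M₂ a₁ N) (ha₂ : ∀ i, a₂ i ∈ M₂.carrier)
    (hbs : (s.elongation β lam th).Basic M₀ a₂ N) :
    ∃ M₁ N', (∀ i, a₁ i ∈ M₁.carrier) ∧ K.Prec N N' ∧
      (s.elongation β lam th).nf M₀ M₁ a₂ N' := by
  obtain ⟨-, -, h₂N, -, Y, hNY, hind₁⟩ := hs.elongation_nf_iff.1 h
  obtain ⟨-, hM₂, -, h₀₂, -⟩ := hs.indepBelow_domain hind₁
  obtain ⟨h₀N, ha₂N, hbs⟩ := hbs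
  rw [← tp_eq_of_prec h₂N h₀₂ h₀N ha₂ ha₂N] at hbs
  obtain ⟨hn, -, -, -, X, hM₂X, hind₂⟩ := hs.elongation_nf_iff.1
    (hs.elongation_nf_of_doesNotFork hs.hasAmalgamation hM₂
      (FrameTriple.elongation_mem_bs_iff.1 hbs))
  obtain ⟨-, -, hX, -⟩ := hs.indepBelow_domain hind₂
  obtain ⟨Q, X', k, hYQ, hk, hkM₂, hindQ⟩ := hs.exists_isIso_indepBelow hind₁ hM₂X hX
  have hkM₀ : IsIso k M₀ M₀ := IsIso.of_fixed fun x hx => hkM₂ x (h₀₂.subset hx)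
  obtain ⟨M₁, N', hQN', hind₁', hind₂'⟩ := hs.indepBelow_exchange
    (hs.indepBelow_iso hkM₀ hkM₀ hind₂ hk fun i => hkM₂ _ (ha₂ i)) hindQ
  obtain ⟨-, -, -, -, -, ha₁⟩ := hs.indepBelow_domain hind₁'
  exact ⟨M₁, N', ha₁, K.trans hNY (K.trans hYQ hQN'), hs.elongation_nf_of_indepBelow hn hind₂'⟩

theorem elongation_transitivity (p : GType K M₂ n) (h : K.Prec M₁ M₂)
    (hp : (s.elongation β lam th).DoesNotFork p M₁)
    (hp' : (s.elongation β lam th).DoesNotFork (p.restrict h le_rfl) M₀) :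
    (s.elongation β lam th).DoesNotFork p M₀ := by
  obtain ⟨hn, a, N, h₂N, ha, rfl, hind⟩ := hs.elongation_doesNotFork_iff.1 hp
  obtain ⟨-, -, hN, -⟩ := hs.indepBelow_domain hind
  obtain ⟨-, -, -, -, N₁, hNN₁, hind'⟩ :=
    hs.elongation_nf_iff.1 (hs.elongation_nf_of_doesNotFork hs.hasAmalgamation hN hp')
  obtain ⟨h₀, -, hN₁, h₀₁, -⟩ := hs.indepBelow_domain hind'
  exact hs.elongation_doesNotFork_iff.2 ⟨hn, a, N₁, K.trans h₂N hNN₁,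
    fun i => hNN₁.subset (ha i), tp_eq_of_prec hNN₁ _ _ _ _,
    hs.indepBelow_trans (hs.indepBelow_up hind hNN₁ hN₁) h₀ h₀₁ (hs.nf_of_indepBelow hind')⟩

theorem elongation_doesNotFork_of_coord {p : GType K M₁ n}
    (hp : p ∈ (s.elongation β lam th).bs M₁ n) (hM₀ : K.InF lam th M₀) (h₀₁ : K.Prec M₀ M₁)
    (h : ∀ k hk, s.DoesNotFork (p.coord k hk) M₀) :
    (s.elongation β lam th).DoesNotFork p M₀ := by
  obtain ⟨hn, a, N, h₁N, ha, rfl, hind⟩ :=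
    hs.elongation_doesNotFork_iff.1 (FrameTriple.elongation_mem_bs_iff.1 hp)
  obtain ⟨-, -, hN, -⟩ := hs.indepBelow_domain hind
  exact hs.elongation_doesNotFork_iff.2 ⟨hn, a, N, h₁N, ha, rfl,
    hs.indepBelow_trans hind hM₀ h₀₁ fun i =>
      (hs.doesNotFork_tp_iff hs.hasAmalgamation hN).1 (h i i.2)⟩

end IsGoodExceptStability

end Elongation

/-! ### Local character and continuity -/

section Chains

open AEC

variable {L : FirstOrder.Language.{u, u}} {K : AEC L} {lam : Cardinal.{u}}
  {th : WithTop Cardinal.{u}} {s : FrameTriple K} {α β : ℕ∞} {n : ℕ} {δ i₀ : Ordinal.{u}}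
  {M : Ordinal.{u} → Model L}

theorem exists_lt_forall_le (hi₀ : i₀ < δ) {J : Fin n → Ordinal.{u}} (hJ : ∀ k, J k < δ) :
    ∃ j < δ, i₀ ≤ j ∧ ∀ k, J k ≤ j :=
  ⟨max i₀ (Finset.univ.sup J),
    max_lt hi₀ ((Finset.sup_lt_iff (bot_le.trans_lt hi₀)).2 fun k _ => hJ k), le_max_left _ _,
    fun k => (Finset.le_sup (Finset.mem_univ k)).trans (le_max_right _ _)⟩

theorem IncreasingContinuous.rel {r : Model L → Model L → Prop}
    (hM : IncreasingContinuous r (Order.succ δ) M) {i j : Ordinal.{u}} (hij : i ≤ j)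
    (hj : j ≤ δ) : r (M i) (M j) :=
  hM.1 i j hij (Order.lt_succ_of_le hj)

theorem IncreasingContinuous.max_const (hM : IncreasingContinuous K.Prec (Order.succ δ) M)
    (hi₀ : i₀ < δ) : IncreasingContinuous K.Prec (Order.succ δ) fun i => M (max i i₀) := by
  have max_le_of_lt {i : Ordinal.{u}} (hi : i < Order.succ δ) : max i i₀ ≤ δ :=
    max_le (Order.le_of_lt_succ hi) hi₀.le
  refine ⟨fun i j hij hj => hM.rel (max_le_max_right _ hij) (max_le_of_lt hj), fun i hi hlim =>
    ⟨?_, fun j hj => K.isSubstructure (hM.rel (max_le_max_right _ hj.le) (max_le_of_lt hi))⟩⟩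
  ext x
  rcases le_or_gt i i₀ with h | h
  · simp only [Set.mem_ofPred_eq, max_eq_right h]
    refine ⟨fun hx => ⟨0, hlim.bot_lt, by rwa [max_eq_right zero_le]⟩, ?_⟩
    rintro ⟨j, hj, hx⟩
    rwa [max_eq_right (hj.le.trans h)] at hx
  · simp only [Set.mem_ofPred_eq, max_eq_left h.le, (hM.2 i hi hlim).1]
    constructor
    · rintro ⟨j, hj, hx⟩
      exact ⟨j, hj, Prec.subset (hM.rel (le_max_left _ _) (max_le_of_lt (hj.trans hi))) hx⟩
    · rintro ⟨j, hj, hx⟩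
      exact ⟨_, max_lt hj h, hx⟩

theorem exists_lt_of_isLUB_image {ℓ : Ordinal.{u} → ℕ} (hδ : Order.IsSuccLimit δ)
    (hℓ : IsLUB (ℓ '' Set.Iio δ) (ℓ δ)) : ∃ i < δ, ℓ i = ℓ δ := by
  have hne : (ℓ '' Set.Iio δ).Nonempty := ⟨_, 0, hδ.bot_lt, rfl⟩
  exact hℓ.csSup_eq hne ▸ Nat.sSup_mem hne hℓ.bddAbove

namespace IsGoodExceptStability

variable (hs : IsGoodExceptStability α lam th s)
include hs

theorem elongation_local_character (hδ : Order.IsSuccLimit δ)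
    (hM : IncreasingContinuous K.Prec (Order.succ δ) M) (hMF : ∀ i ≤ δ, K.InF lam th (M i))
    {p : GType K (M δ) n} (hp : p ∈ (s.elongation β lam th).bs (M δ) n) :
    ∃ i < δ, (s.elongation β lam th).DoesNotFork p (M i) := by
  choose J hJ hpJ using fun k : Fin n =>
    hs.local_character hδ hM hMF (p.coord k k.2) (hs.coord_mem_bs hp k k.2)
      (by simpa using Ordinal.one_lt_cof_iff.2 hδ)
  obtain ⟨j, hj, -, hJj⟩ := exists_lt_forall_le hδ.bot_lt hJ
  have hjδ := hM.rel hj.le le_rfl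
  exact ⟨j, hj, hs.elongation_doesNotFork_of_coord hp (hMF j hj.le) hjδ fun k hk =>
    hs.doesNotFork_base (hpJ ⟨k, hk⟩) (hM.rel (hJj _) hj.le) hjδ⟩

theorem exists_doesNotFork_of_chain (hδ : Order.IsSuccLimit δ)
    (hM : IncreasingContinuous K.Prec (Order.succ δ) M) (hMF : ∀ i ≤ δ, K.InF lam th (M i))
    (hi₀ : i₀ < δ) {p : ∀ i, i₀ ≤ i → i < δ → GType K (M i) 1}
    (hp : ∀ i h hi, p i h hi ∈ s.bs (M i) 1)
    (hext : ∀ j i (h : i₀ ≤ j) (hji : j ≤ i) (hi : i < δ),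
      (p i (h.trans hji) hi).Extends (p j h (hji.trans_lt hi))) :
    ∃ j < δ, ∃ h : i₀ ≤ j, ∀ i (hji : j ≤ i) (hi : i < δ),
      s.DoesNotFork (p i (h.trans hji) hi) (M j) := by
  have hα : ((1 : ℕ) : ℕ∞) < α := (hs.bs_subset _ (hp i₀ le_rfl hi₀)).2.1
  have hM' := hM.max_const hi₀
  have hMF' : ∀ i ≤ δ, K.InF lam th (M (max i i₀)) := fun i hi => hMF _ (max_le hi hi₀.le)
  obtain ⟨q, hq, hqp, -⟩ := hs.continuity (ℓ := fun _ => 1) hδ hM' hMF' (fun _ _ => hα)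
    (fun _ _ _ _ => le_rfl)
    (fun i _ hi => by
      rw [Set.Nonempty.image_const ⟨0, hi.bot_lt⟩]
      exact isLUB_singleton)
    (fun i hi => p (max i i₀) (le_max_right _ _) (max_lt hi hi₀)) (fun i hi => hp _ _ _)
    (fun j i hji hi => hext _ _ _ (max_le_max_right i₀ hji.le) _)
  obtain ⟨j, hj, hqj⟩ := hs.local_character hδ hM' hMF' q hq
    (by simpa using Ordinal.one_lt_cof_iff.2 hδ)
  refine ⟨max j i₀, max_lt hj hi₀, le_max_right _ _, fun i hji hi => ?_⟩
  have extends_of_max_eq : ∀ i' (h' : i₀ ≤ i') (hi' : i' < δ), max i i₀ = i' →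
      q.Extends (p i' h' hi') := by
    rintro _ _ _ rfl
    exact hqp i hi
  have hi₀i : i₀ ≤ i := (le_max_right _ _).trans hji
  obtain ⟨h, hm, hqi⟩ := extends_of_max_eq i hi₀i hi (max_eq_left hi₀i)
  exact hqi ▸ hs.doesNotFork_restrict hqj (hM.rel hji hi.le) h hm

theorem exists_elongation_doesNotFork_of_chain (hδ : Order.IsSuccLimit δ)
    (hM : IncreasingContinuous K.Prec (Order.succ δ) M) (hMF : ∀ i ≤ δ, K.InF lam th (M i))
    (hi₀ : i₀ < δ) {p : ∀ i, i₀ ≤ i → i < δ → GType K (M i) n}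
    (hp : ∀ i h hi, p i h hi ∈ (s.elongation β lam th).bs (M i) n)
    (hext : ∀ j i (h : i₀ ≤ j) (hji : j ≤ i) (hi : i < δ),
      (p i (h.trans hji) hi).Extends (p j h (hji.trans_lt hi))) :
    ∃ j < δ, ∃ h : i₀ ≤ j, ∀ i (hji : j ≤ i) (hi : i < δ),
      (s.elongation β lam th).DoesNotFork (p i (h.trans hji) hi) (M j) := by
  choose J hJ hi₀J hpJ using fun k : Fin n => hs.exists_doesNotFork_of_chain hδ hM hMF hi₀
    (p := fun i h hi => (p i h hi).coord k k.2) (fun i h hi => hs.coord_mem_bs (hp i h hi) k k.2)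
    (fun j i h hji hi => (hext j i h hji hi).coord _ _)
  obtain ⟨j, hj, hi₀j, hJj⟩ := exists_lt_forall_le hi₀ hJ
  exact ⟨j, hj, hi₀j, fun i hji hi => hs.elongation_doesNotFork_of_coord (hp i _ hi)
    (hMF j hj.le) (hM.rel hji hi.le) fun k hk => hs.doesNotFork_base
      (hpJ ⟨k, hk⟩ i ((hJj _).trans hji) hi) (hM.rel (hJj _) hj.le) (hM.rel hji hi.le)⟩

theorem exists_elongation_limit_of_chain (hδ : Order.IsSuccLimit δ)
    (hM : IncreasingContinuous K.Prec (Order.succ δ) M) (hMF : ∀ i ≤ δ, K.InF lam th (M i))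
    (hi₀ : i₀ < δ) {p : ∀ i, i₀ ≤ i → i < δ → GType K (M i) n}
    (hp : ∀ i h hi, p i h hi ∈ (s.elongation β lam th).bs (M i) n)
    (hext : ∀ j i (h : i₀ ≤ j) (hji : j ≤ i) (hi : i < δ),
      (p i (h.trans hji) hi).Extends (p j h (hji.trans_lt hi))) :
    ∃ q ∈ (s.elongation β lam th).bs (M δ) n, (∀ i h hi, q.Extends (p i h hi)) ∧
      ∀ M₀, (∀ i h hi, (s.elongation β lam th).DoesNotFork (p i h hi) M₀) →
        (s.elongation β lam th).DoesNotFork q M₀ := by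
  obtain ⟨j, hj, hi₀j, hpj⟩ := hs.exists_elongation_doesNotFork_of_chain hδ hM hMF hi₀ hp hext
  obtain ⟨q, hq, hqj, hjδ, _, hqp⟩ := hs.elongation_existence (hp j hi₀j hj)
    (hM.rel hj.le le_rfl) (hMF δ le_rfl) le_rfl (hp j hi₀j hj).1
  refine ⟨q, hq, fun i h hi => ?_, fun M₀ hM₀ =>
    hs.elongation_transitivity q hjδ hqj (hqp ▸ hM₀ j hi₀j hj)⟩
  have hji : K.Prec (M j) (M (max i j)) := hM.rel (le_max_right _ _) (max_le hi.le hj.le)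
  have hiδ : K.Prec (M (max i j)) (M δ) := hM.rel (max_le hi.le hj.le) le_rfl
  have restrict_eq : q.restrict hiδ le_rfl = p (max i j) (h.trans (le_max_left _ _))
      (max_lt hi hj) := by
    obtain ⟨_, _, hpp⟩ := hext j (max i j) hi₀j (le_max_right _ _) (max_lt hi hj)
    refine hs.elongation_uniqueness _ _ hji
      ((hs.toIsPreFrame.elongation hs.hasAmalgamation).doesNotFork_restrict hqj hji hiδ le_rfl)
      (hpj _ (le_max_right _ _) _) ?_
    rw [q.restrict_restrict, hqp, hpp]
  exact GType.Extends.trans ⟨hiδ, le_rfl, restrict_eq⟩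
    (hext i (max i j) h (le_max_left _ _) (max_lt hi hj))

theorem elongation_continuity {ℓ : Ordinal.{u} → ℕ} (hδ : Order.IsSuccLimit δ)
    (hM : IncreasingContinuous K.Prec (Order.succ δ) M) (hMF : ∀ i ≤ δ, K.InF lam th (M i))
    (hℓ : ∀ i j, i ≤ j → j ≤ δ → ℓ i ≤ ℓ j) (hlub : IsLUB (ℓ '' Set.Iio δ) (ℓ δ))
    (p : ∀ i, i < δ → GType K (M i) (ℓ i))
    (hp : ∀ i hi, p i hi ∈ (s.elongation β lam th).bs (M i) (ℓ i))
    (hext : ∀ j i (hji : j < i) (hi : i < δ), (p i hi).Extends (p j (hji.trans hi))) :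
    ∃ q ∈ (s.elongation β lam th).bs (M δ) (ℓ δ), (∀ i hi, q.Extends (p i hi)) ∧
      ((∀ i hi, (s.elongation β lam th).DoesNotFork (p i hi) (M 0)) →
        (s.elongation β lam th).DoesNotFork q (M 0)) := by
  have hs' : IsPreFrame β lam th (s.elongation β lam th) :=
    hs.toIsPreFrame.elongation hs.hasAmalgamation
  have hext' : ∀ j i (hji : j ≤ i) (hi : i < δ), (p i hi).Extends (p j (hji.trans_lt hi)) := by
    intro j i hji hi
    rcases hji.eq_or_lt with rfl | hji
    · exact .refl _ (hMF j hi.le).1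
    · exact hext j i hji hi
  obtain ⟨i₀, hi₀, hℓi₀⟩ := exists_lt_of_isLUB_image hδ hlub
  have hM_refl : ∀ i < δ, K.Prec (M i) (M i) := fun i hi => hM.rel le_rfl hi.le
  have le_length : ∀ i, i₀ ≤ i → i < δ → ℓ δ ≤ ℓ i := fun i h hi => hℓi₀ ▸ hℓ i₀ i h hi.le
  have doesNotFork_restrict : ∀ i h hi M₀, K.Prec M₀ (M i) →
      (s.elongation β lam th).DoesNotFork (p i hi) M₀ → (s.elongation β lam th).DoesNotFork
        ((p i hi).restrict (hM_refl i hi) (le_length i h hi)) M₀ := fun i h hi M₀ hM₀ hpi =>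
    hs'.doesNotFork_restrict hpi hM₀ _ _
  -- Restricting to the first `ℓ δ` coordinates makes the lengths constant from `i₀` on.
  obtain ⟨q, hq, hqp, hq₀⟩ := hs.exists_elongation_limit_of_chain hδ hM hMF hi₀
    (p := fun i h hi => (p i hi).restrict (hM_refl i hi) (le_length i h hi))
    (fun i h hi => FrameTriple.elongation_mem_bs_iff.2 (doesNotFork_restrict i h hi _
      (hM_refl i hi) (FrameTriple.elongation_mem_bs_iff.1 (hp i hi))))
    (fun j i h hji hi => ((hext' j i hji hi).trans ⟨_, _, rfl⟩).restrict _
      (hM.rel hji hi.le) _ le_rfl)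
  refine ⟨q, hq, fun i hi => ?_, fun h₀ => hq₀ _ fun i h hi =>
    doesNotFork_restrict i h hi _ (hM.rel zero_le hi.le) (h₀ i hi)⟩
  have hmax : max i i₀ < δ := max_lt hi hi₀
  exact (hqp (max i i₀) (le_max_right _ _) hmax).trans
    ((hext' i (max i i₀) (le_max_left _ _) hmax).restrict _ (hM.rel (le_max_left _ _) hmax.le) _
      (hℓ i δ hi.le le_rfl))

end IsGoodExceptStability

end Chains

namespace IsGoodExceptStability

theorem elongation {L : FirstOrder.Language.{u, u}} {K : AEC L} {lam : Cardinal.{u}}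
    {th : WithTop Cardinal.{u}} {s : FrameTriple K} {α β : ℕ∞}
    (hs : IsGoodExceptStability α lam th s) (hβ : 1 < β) :
    IsGoodExceptStability β lam th (s.elongation β lam th) where
  toIsPreFrame := hs.toIsPreFrame.elongation hs.hasAmalgamation
  amalgamation := hs.amalgamation
  joint_embedding := hs.joint_embedding
  no_maximal_models := hs.no_maximal_models
  density hM hN hMN hne := by
    obtain ⟨a, ha, h, h', hbs⟩ := hs.density hM hN hMN hne
    exact ⟨a, ha, h, h', hs.elongation_bs_one hβ ▸ hbs⟩
  existence _ hp hMN hN hmn hn := hs.elongation_existence hp hMN hN hmn hn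
  uniqueness p q h _ hp hq hpq := hs.elongation_uniqueness p q h hp hq hpq
  symmetry h _ ha hbs := hs.elongation_symmetry h ha hbs
  local_character hδ hM hMF _ hp _ := hs.elongation_local_character hδ hM hMF hp
  continuity hδ hM hMF _ hℓ hlub p hp hext :=
    hs.elongation_continuity hδ hM hMF hℓ (hlub _ le_rfl hδ) p hp hext
  transitivity p _ h _ hp hp' := hs.elongation_transitivity p h hp hp'

end IsGoodExceptStability

end GoodFrame

theorem corollary4p6_general {L : FirstOrder.Language.{u, u}} {K : GoodFrame.AEC L}
    {lam : Cardinal.{u}} {th : WithTop Cardinal.{u}} {s : GoodFrame.FrameTriple K} {α β : ℕ∞}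
    (hβ : 1 < β) :
    (GoodFrame.IsGood α lam th s → GoodFrame.IsGood β lam th (s.elongation β lam th)) ∧
      (GoodFrame.IsGoodExceptStability α lam th s →
        GoodFrame.IsGoodExceptStability β lam th (s.elongation β lam th)) := by
  refine ⟨fun hs => ⟨hs.toIsGoodExceptStability.elongation hβ, fun hM => ?_⟩,
    fun hs => hs.elongation hβ⟩
  rw [hs.elongation_bs_one hβ]
  exact hs.bs_stability hM

/-- Let `𝓕 = [lam, th)`. A good `𝓕`-frame is a good `(<2, 𝓕)`-frame (a frame for sequences of
length at most one); its elongation to finite tuples is a good `(<ω, 𝓕)`-frame, and likewise for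
frames that are good except possibly for bs-stability. -/
theorem corollary4p6 {L : FirstOrder.Language.{u, u}} (K : GoodFrame.AEC L) (lam : Cardinal.{u})
    (th : WithTop Cardinal.{u}) (s : GoodFrame.FrameTriple K) :
    (GoodFrame.IsGood 2 lam th s → GoodFrame.IsGood ⊤ lam th (s.elongation ⊤ lam th)) ∧
      (GoodFrame.IsGoodExceptStability 2 lam th s →
        GoodFrame.IsGoodExceptStability ⊤ lam th (s.elongation ⊤ lam th)) :=
  corollary4p6_general (by norm_num)
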